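/- There is an absolute constant $c>0$ such that the following holds for all integers $n>0$ and $r\ge 2$ with $r\mid n$. Let the elements of $[n]=\{1,\dots,n\}$, as inputs and as outputs of functions $f\colon[n]\to[n]$, be encoded injectively (in any fixed way) by strings of $q=\lceil\log_2 n\rceil$ bits, and let $O_f$ be the XOR oracle $|i\rangle|b\rangle\mapsto|i\rangle|b\oplus f(i)\rangle$ on $2q$ qubits, where $\oplus$ is bitwise XOR, and where $O_f$ acts as the identity if the first register holds a string that encodes no element of $[n]$. A quantum algorithm with $T$ queries acts on these $2q$ qubits and any finite number of workspace qubits; it is given by unitaries $U_0,\dots,U_T$ and an orthogonal projection $\Pi$, and on the oracle $O_f$ it asserts "$r$-to-one" with probability $P(f)=\|\Pi U_TO_fU_{T-1}O_f\cdots U_1O_fU_0|0\rangle\|^2$ and "one-to-one" with probability $1-P(f)$. A function $f\colon[n]\to[n]$ is $r$-to-one if every element of its image has exactly $r$ preimages. If such an algorithm satisfies $1-P(f)\ge 2/3$ for at least $99\%$ of all one-to-one functions $f\colon[n]\to[n]$ and $P(f)\ge 2/3$ for at least $99\%$ of all $r$-to-one functions $f\colon[n]\to[n]$, then $T\ge c\,(n/r)^{1/3}$.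 That is, any quantum algorithm that determines, with probability at least $2/3$, the type of the input function for $99\%$ of the one-to-one functions and $99\%$ of the $r$-to-one functions must make $\Omega((n/r)^{1/3})$ queries to $O_f$. -/

import Mathlib

namespace XorCollision

/-- Bit strings of length `q`; they label the computational basis of `q` qubits. -/
abbrev Bits (q : ℕ) : Type := Fin q → Bool

/-- Computational basis of a register of `q` query qubits, a register of `q` answer qubits and a
workspace of `a` further qubits. -/
abbrev RegBasis (q a : ℕ) : Type := Bits q × Bits q × Bits a

/-- Bitwise XOR of two bit strings. -/
def bxor {q : ℕ} (y z : Bits q) : Bits q := fun k => Bool.xor (y k) (z k)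

/-- The function `f : [n] → [n]` as a map of bit strings: the code `eIn i` is sent to the code
`eOut (f i)`; bit strings that do not encode an element of `[n]` are sent to the zero string. -/
noncomputable def encodedFun {n q : ℕ} (eIn eOut : Fin n ↪ Bits q) (f : Fin n → Fin n) :
    Bits q → Bits q :=
  Function.extend eIn (fun i => eOut (f i)) (fun _ _ => false)

/-- The action `|x⟩|y⟩|w⟩ ↦ |x⟩|y ⊕ f(x)⟩|w⟩` of the XOR oracle on basis states. -/
noncomputable def oracleMap {n q : ℕ} (eIn eOut : Fin n ↪ Bits q) (f : Fin n → Fin n) {a : ℕ}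
    (b : RegBasis q a) : RegBasis q a :=
  (b.1, bxor b.2.1 (encodedFun eIn eOut f b.1), b.2.2)

/-- The matrix of the XOR oracle `O_f` (acting trivially on the workspace). -/
noncomputable def oracle {n q : ℕ} (eIn eOut : Fin n ↪ Bits q) (f : Fin n → Fin n) (a : ℕ) :
    Matrix (RegBasis q a) (RegBasis q a) ℂ :=
  Matrix.of fun b' b => if b' = oracleMap eIn eOut f b then 1 else 0

/-- A quantum query algorithm `U 0 → O → U 1 → O → ⋯ → O → U queries → proj`, using an oracle `O`
on `q` query and `q` answer qubits: the number of workspace qubits, the number of queries, arbitrary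
unitaries on all qubits (only those with index at most `queries` are applied), and an orthogonal
projection for the final measurement. -/
structure QueryAlgorithm (q : ℕ) where
  work : ℕ
  queries : ℕ
  U : ℕ → Matrix.unitaryGroup (RegBasis q work) ℂ
  proj : Matrix (RegBasis q work) (RegBasis q work) ℂ
  proj_isStarProjection : IsStarProjection proj

namespace QueryAlgorithm

variable {q : ℕ} (A : QueryAlgorithm q)

/-- The initial state `|0⟩` of all the qubits. -/
noncomputable def initState : RegBasis q A.work → ℂ :=
  Pi.single (fun _ => false, fun _ => false, fun _ => false) 1

/-- The state `U_t O U_{t-1} O ⋯ O U_0 |0⟩` after `t` queries to `O`. -/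
noncomputable def state (O : Matrix (RegBasis q A.work) (RegBasis q A.work) ℂ) :
    ℕ → (RegBasis q A.work → ℂ)
  | 0 => (A.U 0 : Matrix _ _ ℂ).mulVec A.initState
  | t + 1 => (A.U (t + 1) : Matrix _ _ ℂ).mulVec (O.mulVec (state O t))

/-- The probability `‖Π U_T O U_{T-1} O ⋯ O U_0 |0⟩‖²` that the measurement accepts. -/
noncomputable def acceptProb (O : Matrix (RegBasis q A.work) (RegBasis q A.work) ℂ) : ℝ :=
  ∑ b, ‖A.proj.mulVec (A.state O A.queries) b‖ ^ 2

/-- The probability that the algorithm, given the XOR oracle for `f`, asserts "`r`-to-one"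
(it accepts). -/
noncomputable def probRToOne {n : ℕ} (eIn eOut : Fin n ↪ Bits q) (f : Fin n → Fin n) : ℝ :=
  A.acceptProb (oracle eIn eOut f A.work)

/-- The probability that the algorithm, given the XOR oracle for `f`, asserts "one-to-one"
(it does not accept). -/
noncomputable def probOneToOne {n : ℕ} (eIn eOut : Fin n ↪ Bits q) (f : Fin n → Fin n) : ℝ :=
  1 - A.probRToOne eIn eOut f

end QueryAlgorithm

/-- `f` is `r`-to-one: every element of the image has exactly `r` preimages. -/
def IsRToOne {n : ℕ} (r : ℕ) (f : Fin n → Fin n) : Prop :=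
  ∀ y ∈ Set.range f, (f ⁻¹' {y}).ncard = r

/-- The one-to-one functions `[n] → [n]`. -/
def oneToOneFuns (n : ℕ) : Set (Fin n → Fin n) := {f | Function.Injective f}

/-- The `r`-to-one functions `[n] → [n]`. -/
def rToOneFuns (n r : ℕ) : Set (Fin n → Fin n) := {f | IsRToOne r f}

/-- With probability at least `2/3`, the algorithm determines the type of `f` correctly, for at
least 99% of the one-to-one functions and at least 99% of the `r`-to-one functions `f`. -/
def Distinguishes {q n : ℕ} (A : QueryAlgorithm q) (eIn eOut : Fin n ↪ Bits q) (r : ℕ) : Prop :=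
  (99 / 100 : ℝ) * (oneToOneFuns n).ncard
      ≤ {f ∈ oneToOneFuns n | 2 / 3 ≤ A.probOneToOne eIn eOut f}.ncard ∧
  (99 / 100 : ℝ) * (rToOneFuns n r).ncard
      ≤ {f ∈ rToOneFuns n r | 2 / 3 ≤ A.probRToOne eIn eOut f}.ncard

end XorCollision

/-! ### Bernstein-type inequalities on an interval. -/

namespace XorCollision

open Polynomial

/-! The proof is the polynomial method. After T queries every amplitude is a polynomial of degree at
most T in the indicators of f i = y, so the acceptance probability has degree at most 2T
(`probRToOne_mem_degreeLE`). Take a function that is a-to-one on m points and b-to-one on the other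
n - m. Averaged over all relabellings of inputs and outputs, its acceptance probability is a
polynomial Q(m, a, b) of degree at most 2T (`exists_poly_sum_perm`). For a, b > 0 and m ≤ n with a ∣
m and b ∣ n - m, such a function exists, so Q lies in [0, 1] there.

Put N = n / r and M = r⌊N/2⌋. The hypotheses give Q(M, 1, 1) ≤ 0.34 and Q(M, r, r) ≥ 0.66, so Q(M,
1, r) is far from one of these values. Suppose it is far from the first, and let t = ⌊N^(1/3)⌋. The
polynomial g(x) = Q(M, 1, x) varies between 1 and r. If |g| ≤ 2 at the positive integers up to r t²,
Bernstein's inequality near the end of that interval forces a degree of order √(r t² / r) = t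
(`sub_le_of_variation`). If |g(k)| > 2 for one of these integers k, then h(x) = Q(n - k x, 1, k)
lies in [0, 1] at the integers up to n / k, yet is large at (n - M) / k, near the middle; this
forces a degree of order n / k ≥ t (`le_of_large_in_middle`). The other case is the same with g(x) =
Q(M, r x, r) and integers up to t². -/

/-- Growth of `p ∘ cos` off the real axis, for a polynomial bounded on `[-1, 1]`. -/
theorem norm_aeval_cos_le {p : ℝ[X]} {d : ℕ} {C : ℝ} (hd : p.natDegree ≤ d)
    (hC : ∀ x ∈ Set.Icc (-1 : ℝ) 1, |p.eval x| ≤ C) (z : ℂ) :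
    ‖aeval (Complex.cos z) p‖ ≤ C * Real.exp (d * |z.im|) := by
  -- This is w ^ d * p((w + w⁻¹) / 2) with the pole at 0 cleared. On the unit circle (w + w⁻¹) / 2
  -- is a cosine, so the maximum principle bounds `f` on the disc.
  set f : ℂ → ℂ := fun w => ∑ j ∈ Finset.range (d + 1),
    (p.coeff j : ℂ) * (((w ^ 2 + 1) / 2) ^ j * w ^ (d - j)) with hf
  have hfz : ∀ z : ℂ, f (Complex.exp (z * Complex.I)) =
      Complex.exp (z * Complex.I) ^ d * aeval (Complex.cos z) p := by
    intro z
    have hw : Complex.exp (z * Complex.I) * Complex.cos z =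
        (Complex.exp (z * Complex.I) ^ 2 + 1) / 2 := by
      have h0 : Complex.exp (z * Complex.I) * Complex.exp (-z * Complex.I) = 1 := by
        rw [← Complex.exp_add]; simp
      rw [Complex.cos, ← h0]; ring
    rw [aeval_eq_sum_range' (Nat.lt_succ_of_le hd), Finset.mul_sum]
    refine Finset.sum_congr rfl fun j hj => ?_
    have hj' : j ≤ d := Nat.lt_succ_iff.mp (Finset.mem_range.mp hj)
    rw [← hw, mul_pow, Complex.real_smul]
    rw [← pow_sub_mul_pow (Complex.exp (z * Complex.I)) hj']
    ring
  have hdisk : ∀ w : ℂ, ‖w‖ ≤ 1 → ‖f w‖ ≤ C := by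
    intro w hw
    refine Complex.norm_le_of_forall_mem_frontier_norm_le (U := Metric.ball 0 1)
      Metric.isBounded_ball (Differentiable.diffContOnCl (by rw [hf]; fun_prop)) ?_ ?_
    · intro u hu
      rw [frontier_ball _ one_ne_zero, mem_sphere_zero_iff_norm] at hu
      have hu' : Complex.exp ((u.arg : ℂ) * Complex.I) = u := by
        have := Complex.norm_mul_exp_arg_mul_I u
        rwa [hu, Complex.ofReal_one, one_mul] at this
      rw [← hu', hfz, norm_mul, norm_pow, Complex.norm_exp_ofReal_mul_I, one_pow, one_mul,
        ← Complex.ofReal_cos]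
      have : aeval ((Real.cos u.arg : ℝ) : ℂ) p = ((p.eval (Real.cos u.arg) : ℝ) : ℂ) := by
        simpa using (aeval_algebraMap_apply ℂ (Real.cos u.arg) p)
      rw [this, Complex.norm_real]
      exact hC _ ⟨Real.neg_one_le_cos _, Real.cos_le_one _⟩
    · rw [closure_ball _ one_ne_zero]; simpa using hw
  have key : ∀ z : ℂ, 0 ≤ z.im → ‖aeval (Complex.cos z) p‖ ≤ C * Real.exp (d * z.im) := by
    intro z hz
    have hn : ‖Complex.exp (z * Complex.I)‖ = Real.exp (-z.im) := by
      rw [Complex.norm_exp]; simp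
    have h := hdisk (Complex.exp (z * Complex.I)) (by rw [hn]; simpa using hz)
    rw [hfz, norm_mul, norm_pow, hn, ← Real.exp_nat_mul] at h
    calc ‖aeval (Complex.cos z) p‖
        = (Real.exp (d * -z.im) * ‖aeval (Complex.cos z) p‖) * Real.exp (d * z.im) := by
          rw [mul_right_comm, ← Real.exp_add]; simp
      _ ≤ C * Real.exp (d * z.im) := by gcongr
  rcases le_total 0 z.im with hz | hz
  · rw [abs_of_nonneg hz]; exact key z hz
  · have := key (-z) (by simpa using hz)
    rwa [Complex.cos_neg, Complex.neg_im, ← abs_of_nonpos hz] at this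

/-- A weak form of Bernstein's inequality. -/
theorem abs_eval_cos_sub_le {p : ℝ[X]} {d : ℕ} {C : ℝ} (hd : p.natDegree ≤ d)
    (hC : ∀ x ∈ Set.Icc (-1 : ℝ) 1, |p.eval x| ≤ C) (s t : ℝ) :
    |p.eval (Real.cos s) - p.eval (Real.cos t)| ≤ 3 * d * C * |s - t| := by
  have hC0 : 0 ≤ C := (abs_nonneg _).trans (hC 0 (by simp))
  have hcast : ∀ x : ℝ, aeval (Complex.cos (x : ℂ)) p = ((p.eval (Real.cos x) : ℝ) : ℂ) := by
    intro x
    rw [← Complex.ofReal_cos]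
    simpa using (aeval_algebraMap_apply ℂ (Real.cos x) p)
  rcases Nat.eq_zero_or_pos d with rfl | hdpos
  · rw [eq_C_of_natDegree_le_zero hd]; simp
  have hdr : (0 : ℝ) < d := by exact_mod_cast hdpos
  set G : ℂ → ℂ := fun z => aeval (Complex.cos z) p with hG
  have hdiff : Differentiable ℂ G := by
    rw [hG]
    exact (Polynomial.differentiable_aeval p).comp Complex.differentiable_cos
  have hder : ∀ x : ℝ, ‖deriv G x‖ ≤ 3 * d * C := by
    intro x
    -- Cauchy's estimate: on a circle of radius 1 / d the growth factor is at most e < 3.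
    have h := Complex.norm_deriv_le_of_forall_mem_sphere_norm_le (c := (x : ℂ)) (R := 1 / d)
      (C := C * 3) (f := G) (by positivity) hdiff.diffContOnCl (by
        intro z hz
        refine (norm_aeval_cos_le hd hC z).trans ?_
        gcongr
        have h1 : |z.im| ≤ 1 / d := by
          rw [mem_sphere_iff_norm] at hz
          rw [← hz]
          simpa using Complex.abs_im_le_norm (z - x)
        calc Real.exp (d * |z.im|) ≤ Real.exp (d * (1 / d)) := by gcongr
          _ = Real.exp 1 := by rw [mul_one_div_cancel hdr.ne']
          _ ≤ 3 := by linarith [Real.exp_one_lt_d9])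
    calc ‖deriv G x‖ ≤ C * 3 / (1 / d) := h
      _ = 3 * d * C := by field_simp
  have hmv := Convex.norm_image_sub_le_of_norm_hasDerivWithin_le (𝕜 := ℝ)
    (f := fun x : ℝ => G x) (f' := fun x : ℝ => deriv G x) (s := Set.univ) (x := t) (y := s)
    (C := 3 * d * C)
    (fun x _ => ((hdiff x).hasDerivAt.comp_ofReal).hasDerivWithinAt)
    (fun x _ => hder x) convex_univ trivial trivial
  simp only [hG, hcast, ← Complex.ofReal_sub, Complex.norm_real, Real.norm_eq_abs] at hmv
  exact hmv

theorem sub_div_pi_le_sin_half {s t : ℝ} (ht : 0 ≤ t) (hst : t ≤ s) (hs : s ≤ Real.pi) :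
    (s - t) / Real.pi ≤ Real.sin ((s - t) / 2) := by
  refine le_trans (le_of_eq ?_) (Real.mul_le_sin (x := (s - t) / 2) (by linarith) (by linarith))
  field_simp

theorem cos_sub_cos_eq (s t : ℝ) :
    Real.cos t - Real.cos s = 2 * Real.sin ((s + t) / 2) * Real.sin ((s - t) / 2) := by
  rw [Real.cos_sub_cos, add_comm t s, ← neg_sub s t, neg_div, Real.sin_neg]; ring

/-- Both sine factors of cos t - cos s are at least |s - t| / π: the one at the half difference by
Jordan's inequality, the one at the half sum because it is larger. Thus arccos is Hölder of exponent
1/2 up to the ends. -/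
theorem abs_sub_le_sqrt_cos {s t : ℝ} (hs : s ∈ Set.Icc 0 Real.pi) (ht : t ∈ Set.Icc 0 Real.pi) :
    |s - t| ≤ Real.pi * √(|Real.cos s - Real.cos t| / 2) := by
  wlog hst : t ≤ s generalizing s t
  · rw [abs_sub_comm, abs_sub_comm (Real.cos s)]
    exact this ht hs (le_of_not_ge hst)
  have hpi := Real.pi_pos
  have h1 := sub_div_pi_le_sin_half ht.1 hst hs.2
  have h2 : Real.sin ((s - t) / 2) ≤ Real.sin ((s + t) / 2) := by
    have h3 : 0 ≤ Real.sin ((s + t) / 2) - Real.sin ((s - t) / 2) := by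
      rw [Real.sin_sub_sin]
      have e1 : ((s + t) / 2 - (s - t) / 2) / 2 = t / 2 := by ring
      have e2 : ((s + t) / 2 + (s - t) / 2) / 2 = s / 2 := by ring
      rw [e1, e2]
      have := Real.sin_nonneg_of_nonneg_of_le_pi (x := t / 2) (by linarith [ht.1])
        (by linarith [ht.2])
      have := Real.cos_nonneg_of_neg_pi_div_two_le_of_le (x := s / 2) (by linarith [hs.1])
        (by linarith [hs.2])
      positivity
    linarith
  have h0 : 0 ≤ (s - t) / Real.pi := div_nonneg (by linarith) hpi.le
  have h4 : ((s - t) / Real.pi) ^ 2 ≤ |Real.cos s - Real.cos t| / 2 := by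
    rw [abs_sub_comm]
    refine le_trans ?_ (div_le_div_of_nonneg_right (le_abs_self _) zero_le_two)
    rw [cos_sub_cos_eq]
    nlinarith
  have h5 := Real.le_sqrt_of_sq_le h4
  rw [abs_of_nonneg (by linarith)]
  rwa [div_le_iff₀' hpi] at h5

/-- Away from ±1 the sine of the half sum is at least 1/2, so only one factor is small and arccos is
Lipschitz. -/
theorem abs_sub_le_cos {s t : ℝ} (hs : s ∈ Set.Icc 0 Real.pi) (ht : t ∈ Set.Icc 0 Real.pi)
    (hs' : |Real.cos s| ≤ 3 / 4) (ht' : |Real.cos t| ≤ 3 / 4) :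
    |s - t| ≤ Real.pi * |Real.cos s - Real.cos t| := by
  wlog hst : t ≤ s generalizing s t
  · rw [abs_sub_comm, abs_sub_comm (Real.cos s)]
    exact this ht hs ht' hs' (le_of_not_ge hst)
  have hpi := Real.pi_pos
  have h1 := sub_div_pi_le_sin_half ht.1 hst hs.2
  have hsin : ∀ {x : ℝ}, x ∈ Set.Icc 0 Real.pi → |Real.cos x| ≤ 3 / 4 → 1 / 2 ≤ Real.sin x := by
    intro x hx hc
    have h0 := Real.sin_nonneg_of_mem_Icc hx
    have h2 := Real.sin_sq_add_cos_sq x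
    have h3 : Real.cos x ^ 2 ≤ (3 / 4) ^ 2 := sq_le_sq' (by linarith [abs_le.mp hc])
      (by linarith [abs_le.mp hc])
    nlinarith
  have hadd : Real.sin s + Real.sin t = 2 * Real.sin ((s + t) / 2) * Real.cos ((s - t) / 2) := by
    have h2 := Real.sin_add ((s + t) / 2) ((s - t) / 2)
    have h3 := Real.sin_sub ((s + t) / 2) ((s - t) / 2)
    rw [show (s + t) / 2 + (s - t) / 2 = s by ring] at h2
    rw [show (s + t) / 2 - (s - t) / 2 = t by ring] at h3
    linarith
  have hpos : 0 ≤ Real.sin ((s + t) / 2) := Real.sin_nonneg_of_nonneg_of_le_pi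
    (by linarith [hs.1, ht.1]) (by linarith [hs.2, ht.2])
  have hhalf : 1 / 2 ≤ Real.sin ((s + t) / 2) := by
    nlinarith [hsin hs hs', hsin ht ht', Real.cos_le_one ((s - t) / 2)]
  have h0 : 0 ≤ (s - t) / Real.pi := div_nonneg (by linarith) hpi.le
  have h4 : (s - t) / Real.pi ≤ |Real.cos s - Real.cos t| := by
    rw [abs_sub_comm]
    refine le_trans ?_ (le_abs_self _)
    rw [cos_sub_cos_eq]
    nlinarith
  rw [abs_of_nonneg (by linarith)]
  rwa [div_le_iff₀' hpi] at h4

section Interval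

variable {p : ℝ[X]} {d : ℕ} {C α β : ℝ}

/-- The substitution x = α + (β - α)(1 - cos s) / 2 carries [0, π] onto [α, β], preserving
orientation. -/
theorem eval_eq_eval_comp_cos (hαβ : α < β) {x : ℝ} (hx : x ∈ Set.Icc α β) :
    ∃ s ∈ Set.Icc 0 Real.pi, Real.cos s = 1 - 2 * (x - α) / (β - α) ∧
      (p.comp (Polynomial.C α + Polynomial.C ((β - α) / 2) * (1 - X))).eval (Real.cos s)
        = p.eval x := by
  have hl : 0 < β - α := sub_pos.mpr hαβ
  have h1 : (x - α) / (β - α) ≤ 1 := (div_le_one hl).mpr (by linarith [hx.2])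
  have h0 : 0 ≤ (x - α) / (β - α) := div_nonneg (by linarith [hx.1]) hl.le
  have hc : Real.cos (Real.arccos (1 - 2 * (x - α) / (β - α))) = 1 - 2 * (x - α) / (β - α) := by
    rw [mul_div_assoc]
    exact Real.cos_arccos (by linarith) (by linarith)
  refine ⟨_, ⟨Real.arccos_nonneg _, Real.arccos_le_pi _⟩, hc, ?_⟩
  rw [hc]
  simp only [eval_comp, eval_add, eval_mul, eval_C, eval_sub, eval_one, eval_X]
  congr 1
  field_simp
  ring

theorem abs_eval_comp_cos_sub_le (hd : p.natDegree ≤ d) (hαβ : α < β)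
    (hC : ∀ x ∈ Set.Icc α β, |p.eval x| ≤ C) (s t : ℝ) :
    |(p.comp (Polynomial.C α + Polynomial.C ((β - α) / 2) * (1 - X))).eval (Real.cos s) -
      (p.comp (Polynomial.C α + Polynomial.C ((β - α) / 2) * (1 - X))).eval (Real.cos t)|
      ≤ 3 * d * C * |s - t| := by
  have hl : 0 < β - α := sub_pos.mpr hαβ
  refine abs_eval_cos_sub_le ?_ ?_ s t
  · rw [natDegree_comp]
    have : (Polynomial.C α + Polynomial.C ((β - α) / 2) * (1 - X) : ℝ[X]).natDegree ≤ 1 := by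
      compute_degree
    nlinarith
  · intro y hy
    simp only [eval_comp, eval_add, eval_mul, eval_C, eval_sub, eval_one, eval_X]
    apply hC
    constructor <;> nlinarith [hy.1, hy.2]

/-- Hölder continuity up to the ends of the interval, from Bernstein's inequality. -/
theorem abs_eval_sub_le_sqrt (hd : p.natDegree ≤ d) (hαβ : α < β)
    (hC : ∀ x ∈ Set.Icc α β, |p.eval x| ≤ C) {x y : ℝ} (hx : x ∈ Set.Icc α β)
    (hy : y ∈ Set.Icc α β) :
    |p.eval x - p.eval y| ≤ 10 * d * C * √(|x - y| / (β - α)) := by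
  have hC0 : 0 ≤ C := (abs_nonneg _).trans (hC x hx)
  obtain ⟨s, hs, hcs, hes⟩ := eval_eq_eval_comp_cos (p := p) hαβ hx
  obtain ⟨t, ht, hct, het⟩ := eval_eq_eval_comp_cos (p := p) hαβ hy
  have hl : 0 < β - α := sub_pos.mpr hαβ
  have h := abs_sub_le_sqrt_cos hs ht
  have e : |Real.cos s - Real.cos t| / 2 = |x - y| / (β - α) := by
    have : Real.cos s - Real.cos t = -(2 * ((x - y) / (β - α))) := by rw [hcs, hct]; ring
    rw [this, abs_neg, abs_mul, abs_div, abs_of_pos hl]; norm_num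
  rw [e] at h
  rw [← hes, ← het]
  refine (abs_eval_comp_cos_sub_le hd hαβ hC s t).trans ?_
  calc 3 * d * C * |s - t| ≤ 3 * d * C * (Real.pi * √(|x - y| / (β - α))) := by gcongr
    _ = (3 * Real.pi) * (d * C * √(|x - y| / (β - α))) := by ring
    _ ≤ 10 * (d * C * √(|x - y| / (β - α))) := by gcongr; linarith [Real.pi_lt_d2]
    _ = _ := by ring

/-- Lipschitz continuity in the middle of the interval, from Bernstein's inequality. -/
theorem abs_eval_sub_le_of_mem_middle (hd : p.natDegree ≤ d) (hαβ : α < β)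
    (hC : ∀ x ∈ Set.Icc α β, |p.eval x| ≤ C) {x y : ℝ}
    (hx : x ∈ Set.Icc (α + (β - α) / 8) (β - (β - α) / 8))
    (hy : y ∈ Set.Icc (α + (β - α) / 8) (β - (β - α) / 8)) :
    |p.eval x - p.eval y| ≤ 20 * d * C * (|x - y| / (β - α)) := by
  have hl : 0 < β - α := sub_pos.mpr hαβ
  have hx' : x ∈ Set.Icc α β := ⟨by linarith [hx.1], by linarith [hx.2]⟩
  have hy' : y ∈ Set.Icc α β := ⟨by linarith [hy.1], by linarith [hy.2]⟩
  have hC0 : 0 ≤ C := (abs_nonneg _).trans (hC x hx')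
  obtain ⟨s, hs, hcs, hes⟩ := eval_eq_eval_comp_cos (p := p) hαβ hx'
  obtain ⟨t, ht, hct, het⟩ := eval_eq_eval_comp_cos (p := p) hαβ hy'
  have hmid : ∀ z ∈ Set.Icc (α + (β - α) / 8) (β - (β - α) / 8),
      |1 - 2 * (z - α) / (β - α)| ≤ 3 / 4 := by
    intro z hz
    have h1 : 1 / 8 ≤ (z - α) / (β - α) := by rw [le_div_iff₀ hl]; linarith [hz.1]
    have h2 : (z - α) / (β - α) ≤ 7 / 8 := by rw [div_le_iff₀ hl]; linarith [hz.2]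
    rw [mul_div_assoc, abs_le]
    constructor <;> linarith
  have h := abs_sub_le_cos hs ht (by rw [hcs]; exact hmid x hx) (by rw [hct]; exact hmid y hy)
  have e : |Real.cos s - Real.cos t| = 2 * (|x - y| / (β - α)) := by
    have : Real.cos s - Real.cos t = -(2 * ((x - y) / (β - α))) := by rw [hcs, hct]; ring
    rw [this, abs_neg, abs_mul, abs_div, abs_of_pos hl]; norm_num
  rw [e] at h
  rw [← hes, ← het]
  refine (abs_eval_comp_cos_sub_le hd hαβ hC s t).trans ?_
  calc 3 * d * C * |s - t| ≤ 3 * d * C * (Real.pi * (2 * (|x - y| / (β - α)))) := by gcongr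
    _ = (3 * Real.pi) * (2 * (d * C * (|x - y| / (β - α)))) := by ring
    _ ≤ 10 * (2 * (d * C * (|x - y| / (β - α)))) := by gcongr; linarith [Real.pi_lt_d2]
    _ = _ := by ring

theorem exists_isMax_abs_eval (p : ℝ[X]) (hαβ : α < β) :
    ∃ z ∈ Set.Icc α β, ∀ x ∈ Set.Icc α β, |p.eval x| ≤ |p.eval z| :=
  isCompact_Icc.exists_isMaxOn (Set.nonempty_Icc.mpr hαβ.le)
    (by fun_prop : Continuous fun x => |p.eval x|).continuousOn

/-- A polynomial that is bounded on a dense enough subset of a long interval and varies near its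
left end has a large degree. -/
theorem sub_le_of_variation (hd : p.natDegree ≤ d) (hαβ : α < β)
    (hnet : ∀ x ∈ Set.Icc α β, ∃ y ∈ Set.Icc α β, |x - y| ≤ 1 ∧ |p.eval y| ≤ 2)
    {u v : ℝ} (hu : u ∈ Set.Icc α β) (huv : u - α ≤ v) (hv : 1 ≤ v)
    (hvar : 1 / 10 ≤ |p.eval u - p.eval α|) :
    β - α ≤ (400 * d) ^ 2 * v := by
  have hl : 0 < β - α := sub_pos.mpr hαβ
  have key : ∀ {c w : ℝ}, 0 ≤ c → 0 ≤ w → 1 ≤ c * √(w / (β - α)) → β - α ≤ c ^ 2 * w := by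
    intro c w hc hw h
    have h2 : 1 ≤ (c * √(w / (β - α))) ^ 2 := one_le_pow₀ h
    rw [mul_pow, Real.sq_sqrt (by positivity), ← mul_div_assoc, le_div_iff₀ hl] at h2
    linarith
  obtain ⟨z, hz, hmax⟩ := exists_isMax_abs_eval p hαβ
  -- If the maximum is at most 4, the variation between `α` and `u` bounds the length. Otherwise the
  -- polynomial loses half of its maximum within distance 1 of `z`, which bounds the length even
  -- better.
  rcases le_or_gt |p.eval z| 4 with h4 | h4
  · have h := abs_eval_sub_le_sqrt hd hαβ (fun x hx => (hmax x hx).trans h4) hu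
      (Set.left_mem_Icc.mpr hαβ.le)
    have h' : 1 ≤ 400 * d * √(v / (β - α)) := by
      have : √(|u - α| / (β - α)) ≤ √(v / (β - α)) := by
        rw [abs_of_nonneg (by linarith [hu.1])]
        gcongr
      have := mul_le_mul_of_nonneg_left this (by positivity : (0 : ℝ) ≤ 400 * d)
      linarith
    exact key (by positivity) (by linarith) h'
  · obtain ⟨y, hy, hzy, hy2⟩ := hnet z hz
    have h := abs_eval_sub_le_sqrt hd hαβ hmax hz hy
    have h1 : |p.eval z| / 2 ≤ |p.eval z - p.eval y| := by
      linarith [abs_sub_abs_le_abs_sub (p.eval z) (p.eval y)]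
    have h2 : √(|z - y| / (β - α)) ≤ √(1 / (β - α)) := by gcongr
    have h3 : 1 ≤ 20 * d * √(1 / (β - α)) := by
      have h5 := mul_le_mul_of_nonneg_left h2 (by positivity : (0 : ℝ) ≤ 10 * d * |p.eval z|)
      have h6 : |p.eval z| * 1 ≤ |p.eval z| * (20 * d * √(1 / (β - α))) := by linarith
      exact le_of_mul_le_mul_left h6 (by linarith)
    have := key (by positivity) zero_le_one h3
    nlinarith [mul_nonneg (Nat.cast_nonneg (α := ℝ) d) (Nat.cast_nonneg (α := ℝ) d)]

end Interval

/-! ### Polynomials bounded at the integers. -/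

/-- These are the denominators in Lagrange interpolation at equally spaced nodes. -/
theorem prod_erase_abs_sub_eq_factorial {d j : ℕ} (hj : j ≤ d) :
    ∏ i ∈ (Finset.range (d + 1)).erase j, |(j : ℝ) - i| = (j.factorial * (d - j).factorial : ℕ) := by
  have hsplit : (Finset.range (d + 1)).erase j =
      Finset.range j ∪ (Finset.range (d - j)).image (fun i => j + 1 + i) := by
    ext i
    simp only [Finset.mem_erase, Finset.mem_range, Finset.mem_union, Finset.mem_image]
    constructor
    · rintro ⟨h1, h2⟩
      rcases lt_or_gt_of_ne h1 with h | h
      · exact Or.inl h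
      · exact Or.inr ⟨i - (j + 1), by omega, by omega⟩
    · rintro (h | ⟨k, hk, rfl⟩) <;> omega
  have hdisj : Disjoint (Finset.range j)
      ((Finset.range (d - j)).image (fun i => j + 1 + i)) := by
    rw [Finset.disjoint_left]
    intro i hi hi'
    simp only [Finset.mem_range, Finset.mem_image] at hi hi'
    obtain ⟨k, -, rfl⟩ := hi'
    omega
  rw [hsplit, Finset.prod_union hdisj, Finset.prod_image (by intro a _ b _ h; simpa using h),
    Nat.cast_mul]
  congr 1
  · rw [← Finset.prod_range_add_one_eq_factorial, ← Finset.prod_range_reflect, Nat.cast_prod]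
    refine Finset.prod_congr rfl fun i hi => ?_
    have hi := Finset.mem_range.mp hi
    have : ((j - 1 - i : ℕ) : ℝ) = j - 1 - i := by
      rw [Nat.cast_sub (by omega), Nat.cast_sub (by omega)]; simp
    rw [this, abs_of_nonneg (by linarith)]
    push_cast; ring
  · rw [← Finset.prod_range_add_one_eq_factorial, Nat.cast_prod]
    refine Finset.prod_congr rfl fun i _ => ?_
    push_cast
    rw [abs_sub_comm, abs_of_nonneg (by linarith [(Nat.cast_nonneg i : (0 : ℝ) ≤ i)])]
    ring

/-- A polynomial of degree at most `d` that is bounded by `1` at the integers of `[0, L]`, with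
`2 * d ≤ L`, is at most exponentially large in `d` on this interval. -/
theorem abs_eval_le_pow_of_bounded_at_integers {p : ℝ[X]} {d L : ℕ} (hd : p.natDegree ≤ d)
    (hd0 : 0 < d) (hL : 2 * d ≤ L) (hp : ∀ i : ℕ, i ≤ L → |p.eval (i : ℝ)| ≤ 1) {x : ℝ}
    (hx : x ∈ Set.Icc 0 (L : ℝ)) : |p.eval x| ≤ 11 ^ d := by
  -- Interpolate at 0, h, …, d h. All distances from `x` to nodes are at most L ≤ 2 d h, so the
  -- basis polynomials add up to at most 4 ^ d * d ^ d / d! ≤ (4 e) ^ d.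
  set h := L / d with hh
  have hh1 : 2 ≤ h := (Nat.le_div_iff_mul_le hd0).mpr hL
  have hhd : h * d ≤ L := Nat.div_mul_le_self L d
  have hhd' : L ≤ 2 * d * h := by
    have := Nat.lt_mul_div_succ L hd0
    rw [← hh] at this
    nlinarith
  have hhr : (0 : ℝ) < h := by exact_mod_cast (by omega : 0 < h)
  have hLr : (L : ℝ) ≤ 2 * d * h := by exact_mod_cast hhd'
  set v : ℕ → ℝ := fun j => ((h * j : ℕ) : ℝ) with hv
  have hinj : Set.InjOn v (Finset.range (d + 1)) := by
    intro a _ b _ hab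
    have hab : h * a = h * b := Nat.cast_injective (R := ℝ) hab
    exact Nat.eq_of_mul_eq_mul_left (by omega) hab
  have hdeg : p.degree < (Finset.range (d + 1)).card := by
    rw [Finset.card_range]
    exact (degree_le_of_natDegree_le hd).trans_lt (by exact_mod_cast Nat.lt_succ_self d)
  have hvL : ∀ j ∈ Finset.range (d + 1), h * j ≤ L := fun j hj =>
    (Nat.mul_le_mul_left h (Nat.lt_succ_iff.mp (Finset.mem_range.mp hj))).trans hhd
  have hbasis : ∀ j ∈ Finset.range (d + 1),
      |(Lagrange.basis (Finset.range (d + 1)) v j).eval x|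
        ≤ (2 * d : ℝ) ^ d / d.factorial * d.choose j := by
    intro j hj
    have hjd : j ≤ d := Nat.lt_succ_iff.mp (Finset.mem_range.mp hj)
    have hcard : ((Finset.range (d + 1)).erase j).card = d := by
      rw [Finset.card_erase_of_mem hj, Finset.card_range]; simp
    have hfac : (d.choose j : ℝ) * (j.factorial * (d - j).factorial : ℕ) = d.factorial := by
      rw [← Nat.choose_mul_factorial_mul_factorial hjd]; push_cast; ring
    calc |(Lagrange.basis (Finset.range (d + 1)) v j).eval x|
        = ∏ i ∈ (Finset.range (d + 1)).erase j, |x - v i| / (h * |(j : ℝ) - i|) := by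
          rw [Lagrange.basis, eval_prod, Finset.abs_prod]
          refine Finset.prod_congr rfl fun i _ => ?_
          rw [Lagrange.basisDivisor, eval_mul, eval_C, eval_sub, eval_X, eval_C, abs_mul, abs_inv,
            ← div_eq_inv_mul]
          congr 1
          rw [hv]
          push_cast
          rw [← mul_sub, abs_mul, abs_of_pos hhr]
      _ ≤ ∏ i ∈ (Finset.range (d + 1)).erase j, (2 * d * h) / (h * |(j : ℝ) - i|) := by
          refine Finset.prod_le_prod (fun i _ => by positivity) fun i hi => ?_
          gcongr
          have h1 : v i ≤ L := Nat.cast_le.mpr (hvL i (Finset.mem_of_mem_erase hi))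
          have h2 : 0 ≤ v i := by rw [hv]; positivity
          rw [abs_le]
          constructor <;> linarith [hx.1, hx.2]
      _ = ∏ i ∈ (Finset.range (d + 1)).erase j, (2 * d) / |(j : ℝ) - i| := by
          refine Finset.prod_congr rfl fun i _ => ?_
          rw [mul_comm (2 * (d : ℝ)), mul_div_mul_left _ _ hhr.ne']
      _ = (2 * d : ℝ) ^ d / (j.factorial * (d - j).factorial : ℕ) := by
          rw [Finset.prod_div_distrib, Finset.prod_const, hcard,
            prod_erase_abs_sub_eq_factorial hjd]
      _ = (2 * d : ℝ) ^ d / d.factorial * d.choose j := by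
          rw [← hfac]
          have : (d.choose j : ℝ) ≠ 0 := by exact_mod_cast (Nat.choose_pos hjd).ne'
          field_simp
  have hsum : p.eval x = ∑ j ∈ Finset.range (d + 1),
      p.eval (v j) * (Lagrange.basis (Finset.range (d + 1)) v j).eval x := by
    conv_lhs => rw [Lagrange.eq_interpolate hinj hdeg, Lagrange.interpolate_apply, eval_finsetSum]
    simp only [eval_mul, eval_C]
  rw [hsum]
  calc |∑ j ∈ Finset.range (d + 1),
        p.eval (v j) * (Lagrange.basis (Finset.range (d + 1)) v j).eval x|
      ≤ ∑ j ∈ Finset.range (d + 1), (2 * d : ℝ) ^ d / d.factorial * d.choose j := by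
        refine (Finset.abs_sum_le_sum_abs _ _).trans (Finset.sum_le_sum fun j hj => ?_)
        rw [abs_mul]
        calc _ ≤ 1 * |(Lagrange.basis (Finset.range (d + 1)) v j).eval x| := by
              gcongr; exact hp _ (hvL j hj)
          _ ≤ _ := by rw [one_mul]; exact hbasis j hj
    _ = 4 ^ d * ((d : ℝ) ^ d / d.factorial) := by
        rw [← Finset.mul_sum, ← Nat.cast_sum, Nat.sum_range_choose, mul_pow]
        push_cast
        rw [show (4 : ℝ) = 2 * 2 by norm_num, mul_pow]; ring
    _ ≤ 4 ^ d * Real.exp d := by gcongr; exact Real.pow_div_factorial_le_exp _ (by positivity) _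
    _ = (4 * Real.exp 1) ^ d := by rw [mul_pow, ← Real.exp_nat_mul, mul_one]
    _ ≤ 11 ^ d := by gcongr; linarith [Real.exp_one_lt_d9]

/-- A polynomial that is bounded by `1` at the integers of `[0, L]` and large somewhere in the
middle of this interval has degree proportional to `L`. -/
theorem le_of_large_in_middle {p : ℝ[X]} {d L : ℕ} (hd : p.natDegree ≤ d)
    (hp : ∀ i : ℕ, i ≤ L → |p.eval (i : ℝ)| ≤ 1) {ξ : ℝ} (h1 : (L : ℝ) / 4 ≤ ξ)
    (h2 : ξ ≤ 3 * L / 4) (hξ : 2 ≤ |p.eval ξ|) : L ≤ 20000 * d := by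
  by_contra! hcon
  rcases Nat.eq_zero_or_pos d with rfl | hd0
  · have h0 := hp 0 (Nat.zero_le _)
    rw [eq_C_of_natDegree_le_zero hd, eval_C] at h0 hξ
    linarith
  have hL0 : (0 : ℝ) < L := by exact_mod_cast (by omega : 0 < L)
  have hLr : (20000 * d : ℝ) < L := by exact_mod_cast hcon
  have hd1 : (1 : ℝ) ≤ d := by exact_mod_cast hd0
  -- A damping factor: 1 at `ξ`, between 0 and 1 on [0, L], and at most (63/64) ^ (200 d) ≤ 11 ^
  -- (-d) at distance L / 8 or more from `ξ`. There it cancels the exponential bound on `p`, so the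
  -- maximum of |q| must lie near `ξ`, where Bernstein's inequality has its Lipschitz form.
  set K : ℝ[X] := (1 - (Polynomial.C (L : ℝ)⁻¹ * (X - Polynomial.C ξ)) ^ 2) ^ (200 * d) with hK
  set q := p * K with hq
  have hKe : ∀ x : ℝ, K.eval x = (1 - ((x - ξ) / L) ^ 2) ^ (200 * d) := by
    intro x
    simp only [hK, eval_pow, eval_sub, eval_one, eval_mul, eval_C, eval_X]
    rw [inv_mul_eq_div]
  have hqd : q.natDegree ≤ 401 * d := by
    refine natDegree_mul_le.trans ?_
    have : K.natDegree ≤ 200 * d * 2 := by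
      refine natDegree_pow_le_of_le _ ?_
      compute_degree
    omega
  have hfrac : ∀ x ∈ Set.Icc 0 (L : ℝ), ((x - ξ) / L) ^ 2 ≤ 1 := by
    intro x hx
    rw [sq_le_one_iff_abs_le_one, abs_div, abs_of_pos hL0, div_le_one hL0, abs_le]
    constructor <;> linarith [hx.1, hx.2]
  have hK0 : ∀ x ∈ Set.Icc 0 (L : ℝ), 0 ≤ K.eval x := by
    intro x hx
    rw [hKe]
    exact pow_nonneg (by linarith [hfrac x hx]) _
  have hK1 : ∀ x ∈ Set.Icc 0 (L : ℝ), K.eval x ≤ 1 := by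
    intro x hx
    rw [hKe]
    exact pow_le_one₀ (by linarith [hfrac x hx]) (by linarith [sq_nonneg ((x - ξ) / L)])
  have hqi : ∀ i : ℕ, i ≤ L → |q.eval (i : ℝ)| ≤ 1 := by
    intro i hi
    have hi' : (i : ℝ) ∈ Set.Icc 0 (L : ℝ) := ⟨by positivity, by exact_mod_cast hi⟩
    rw [hq, eval_mul, abs_mul, abs_of_nonneg (hK0 _ hi')]
    exact mul_le_one₀ (hp i hi) (hK0 _ hi') (hK1 _ hi')
  have hedge : ∀ x ∈ Set.Icc 0 (L : ℝ), (L : ℝ) / 8 ≤ |x - ξ| → |q.eval x| ≤ 1 := by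
    intro x hx hxξ
    rw [hq, eval_mul, abs_mul, abs_of_nonneg (hK0 _ hx)]
    have h3 : K.eval x ≤ (1 / 11) ^ d := by
      rw [hKe, pow_mul]
      refine pow_le_pow_left₀ (pow_nonneg (by linarith [hfrac x hx]) _) ?_ d
      have h4 : (1 / 8 : ℝ) ^ 2 ≤ ((x - ξ) / L) ^ 2 := by
        rw [← sq_abs ((x - ξ) / L), abs_div, abs_of_pos hL0]
        refine pow_le_pow_left₀ (by norm_num) ?_ 2
        rw [le_div_iff₀ hL0]; linarith
      calc (1 - ((x - ξ) / L) ^ 2) ^ 200 ≤ (63 / 64 : ℝ) ^ 200 :=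
            pow_le_pow_left₀ (by linarith [hfrac x hx]) (by linarith) _
        _ ≤ 1 / 11 := by norm_num
    have h5 := abs_eval_le_pow_of_bounded_at_integers hd hd0 (by omega) hp hx
    calc |p.eval x| * K.eval x ≤ 11 ^ d * (1 / 11) ^ d :=
          mul_le_mul h5 h3 (hK0 _ hx) (by positivity)
      _ = 1 := by rw [← mul_pow]; norm_num
  have hqξ : 2 ≤ |q.eval ξ| := by
    rw [hq, eval_mul, hKe]; simpa using hξ
  obtain ⟨z, hz, hmax⟩ := exists_isMax_abs_eval q hL0
  have hz2 : 2 ≤ |q.eval z| := hqξ.trans (hmax ξ ⟨by linarith, by linarith⟩)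
  have hzξ : |z - ξ| < L / 8 := by
    by_contra! hcon'
    linarith [hedge z hz hcon']
  rw [abs_lt] at hzξ
  obtain ⟨y, hy, hy8, hyz⟩ : ∃ y : ℕ, y ≤ L ∧
      (y : ℝ) ∈ Set.Icc (0 + ((L : ℝ) - 0) / 8) (L - (L - 0) / 8) ∧ |z - y| ≤ 1 := by
    -- Rounding towards L / 2 keeps the integer inside the middle region.
    rcases le_or_gt z (L / 2) with hz' | hz'
    · have ha := Nat.le_ceil z
      have hb := Nat.ceil_lt_add_one hz.1
      refine ⟨⌈z⌉₊, ?_, ⟨by linarith, by linarith⟩, ?_⟩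
      · have : ((⌈z⌉₊ : ℕ) : ℝ) ≤ L := by linarith
        exact_mod_cast this
      · rw [abs_le]; constructor <;> linarith
    · have ha := Nat.floor_le hz.1
      have hb := Nat.lt_floor_add_one z
      refine ⟨⌊z⌋₊, ?_, ⟨by linarith, by linarith⟩, ?_⟩
      · have : ((⌊z⌋₊ : ℕ) : ℝ) ≤ L := by linarith [hz.2]
        exact_mod_cast this
      · rw [abs_le]; constructor <;> linarith
  have hlip := abs_eval_sub_le_of_mem_middle hqd hL0 hmax (x := z) (y := y)
    ⟨by linarith, by linarith⟩ hy8
  have h3 : |q.eval z| * (1 / 2) ≤ |q.eval z - q.eval (y : ℝ)| := by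
    linarith [abs_sub_abs_le_abs_sub (q.eval z) (q.eval (y : ℝ)), hqi y hy]
  have h4 : |z - y| / ((L : ℝ) - 0) ≤ 1 / L := by rw [sub_zero]; gcongr
  have h5 := mul_le_mul_of_nonneg_left h4
    (by positivity : (0 : ℝ) ≤ 20 * (401 * d : ℕ) * |q.eval z|)
  have h6 : |q.eval z| * (1 / 2) ≤ |q.eval z| * (20 * (401 * d : ℕ) * (1 / L)) := by linarith
  have h7 := le_of_mul_le_mul_left h6 (by linarith)
  rw [mul_one_div, le_div_iff₀ hL0] at h7
  push_cast at h7
  linarith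

end XorCollision

/-! ### Averaging over relabellings yields a polynomial in (m, a, b). -/

namespace XorCollision

section Symmetrization

variable {V : Type*} [DecidableEq V]

theorem card_image_eq_of_kernel_eq {u w : V → V} {X : Finset V}
    (h : ∀ x ∈ X, ∀ x' ∈ X, u x = u x' ↔ w x = w x') : (X.image u).card = (X.image w).card := by
  have h1 : ((X.image fun x => (u x, w x)).image Prod.fst).card =
      (X.image fun x => (u x, w x)).card := by
    refine Finset.card_image_of_injOn fun p hp q hq hpq => ?_
    simp only [Finset.coe_image, Set.mem_image, Finset.mem_coe] at hp hq
    obtain ⟨x, hx, rfl⟩ := hp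
    obtain ⟨x', hx', rfl⟩ := hq
    exact Prod.ext hpq ((h x hx x' hx').mp hpq)
  have h2 : ((X.image fun x => (u x, w x)).image Prod.snd).card =
      (X.image fun x => (u x, w x)).card := by
    refine Finset.card_image_of_injOn fun p hp q hq hpq => ?_
    simp only [Finset.coe_image, Set.mem_image, Finset.mem_coe] at hp hq
    obtain ⟨x, hx, rfl⟩ := hp
    obtain ⟨x', hx', rfl⟩ := hq
    exact Prod.ext ((h x hx x' hx').mpr hpq) hpq
  rw [Finset.image_image] at h1 h2
  exact h1.trans h2.symm

variable [Fintype V]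

/-- `f` is `a`-to-one on the `m` points that it sends into `A`, and `b`-to-one on all others. -/
def HasProfile (f : V → V) (A : Finset V) (m a b : ℕ) : Prop :=
  (∀ x, f x ∈ A → (Finset.univ.filter fun z => f z = f x).card = a) ∧
  (∀ x, f x ∉ A → (Finset.univ.filter fun z => f z = f x).card = b) ∧
  (Finset.univ.filter fun x => f x ∈ A).card = m

/-- The permutations `σ` for which `f ∘ σ` has the same kernel as `g` on `X`, and takes values in
`A` exactly where `g` takes values in `s`. -/
def compatiblePerms (f g : V → V) (A X s : Finset V) : Finset (Equiv.Perm V) :=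
  Finset.univ.filter fun σ =>
    (∀ x ∈ X, ∀ x' ∈ X, f (σ x) = f (σ x') ↔ g x = g x') ∧ ∀ x ∈ X, f (σ x) ∈ A ↔ g x ∈ s

theorem card_preimage_eq_mul {f : V → V} {H : Finset V} {c : ℕ}
    (h : ∀ y ∈ H, (Finset.univ.filter fun z => f z = y).card = c) :
    (Finset.univ.filter fun z => f z ∈ H).card = H.card * c := by
  rw [Finset.card_eq_sum_card_fiberwise (f := f) (t := H) (by intro z hz; simpa using hz),
    ← smul_eq_mul, ← Finset.sum_const]
  refine Finset.sum_congr rfl fun y hy => ?_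
  rw [← h y hy, Finset.filter_filter]
  congr 1
  ext z
  simp only [Finset.mem_filter, Finset.mem_univ, true_and]
  exact ⟨fun h => h.2, fun h => ⟨h ▸ hy, h⟩⟩

/-- If, for all permutations in a set `W` that does not restrict them outside `X`, there are `c`
admissible values outside `σ '' X` for a further point `x`, then the proportion of the `σ ∈ W` for
which `σ x` is admissible is `c / (|V| - |X|)`. -/
theorem card_filter_perm_mul {W : Finset (Equiv.Perm V)} {X : Finset V} {x : V}
    {R : Equiv.Perm V → V → Prop} [∀ σ z, Decidable (R σ z)]
    (hW : ∀ z ∉ X, ∀ σ, σ * Equiv.swap x z ∈ W ↔ σ ∈ W)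
    (hR : ∀ z ∉ X, ∀ σ y, R (σ * Equiv.swap x z) y ↔ R σ y) {c : ℝ}
    (hc : ∀ σ ∈ W, (((Finset.univ.filter fun z => z ∉ X.image σ ∧ R σ z).card : ℕ) : ℝ) = c) :
    ((Fintype.card V : ℝ) - X.card) * (W.filter fun σ => R σ (σ x)).card = c * W.card := by
  -- Right multiplication by `swap x z` exchanges σ x and σ z, so every `z` outside `X` gives the
  -- same count as `x`. Double counting the pairs (z, σ) then finishes the proof.
  have hz : ∀ z ∈ Xᶜ, (W.filter fun σ => R σ (σ x)).card = (W.filter fun σ => R σ (σ z)).card := by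
    intro z hz
    have hz' : z ∉ X := by simpa using hz
    refine Finset.card_bij' (fun σ _ => σ * Equiv.swap x z) (fun σ _ => σ * Equiv.swap x z)
      ?_ ?_ ?_ ?_
    · intro σ hσ
      rw [Finset.mem_filter] at hσ ⊢
      rw [hW z hz', hR z hz']
      simpa using hσ
    · intro σ hσ
      rw [Finset.mem_filter] at hσ ⊢
      rw [hW z hz', hR z hz']
      simpa using hσ
    · intro σ _
      simp [mul_assoc]
    · intro σ _
      simp [mul_assoc]
  have hσ : ∀ σ ∈ W, ((Xᶜ.filter fun z => R σ (σ z)).card : ℝ) = c := by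
    intro σ hσ
    rw [← hc σ hσ, Nat.cast_inj]
    refine Finset.card_bij' (fun z _ => σ z) (fun z _ => σ.symm z) ?_ ?_ ?_ ?_
    · intro z hz
      simpa using hz
    · intro z hz
      simp only [Finset.mem_image, Finset.mem_filter, Finset.mem_univ, true_and] at hz
      simp only [Finset.mem_filter, Finset.mem_compl, Equiv.apply_symm_apply]
      exact ⟨fun h => hz.1 ⟨_, h, by simp⟩, hz.2⟩
    · intro z _
      simp
    · intro z _
      simp
  have hcard : (Fintype.card V : ℝ) - X.card = (Xᶜ.card : ℕ) := by
    rw [Finset.card_compl, Nat.cast_sub (Finset.card_le_univ X)]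
  have hcount : Xᶜ.card * (W.filter fun σ => R σ (σ x)).card =
      ∑ σ ∈ W, (Xᶜ.filter fun z => R σ (σ z)).card := by
    rw [← smul_eq_mul, ← Finset.sum_const, Finset.sum_congr rfl hz]
    exact Finset.sum_card_bipartiteAbove_eq_sum_card_bipartiteBelow (fun z σ => R σ (σ z))
  rw [hcard, ← Nat.cast_mul, hcount, Nat.cast_sum]
  calc ∑ σ ∈ W, ((Xᶜ.filter fun z => R σ (σ z)).card : ℝ) = ∑ σ ∈ W, c :=
        Finset.sum_congr rfl hσ
    _ = c * W.card := by rw [Finset.sum_const, nsmul_eq_mul, mul_comm]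

/-- The number of admissible values for a further point, as a polynomial in the parameters of a
profile (see `card_admissible_eq`). -/
noncomputable def extensionPoly (g : V → V) (X s : Finset V) (x : V) : MvPolynomial (Fin 3) ℝ :=
  -- The variables 0, 1, 2 stand for `m`, `a`, `b`. A repeated value leaves the unused points of its
  -- fibre; a new value leaves all points on its side of `A` except the fibres already met.
  if g x ∈ X.image g then
    (if g x ∈ s then MvPolynomial.X 1 else MvPolynomial.X 2) -
      MvPolynomial.C ((X.filter fun x' => g x' = g x).card : ℝ)
  else if g x ∈ s then
    MvPolynomial.X 0 -
      MvPolynomial.C (((X.filter fun x' => g x' ∈ s).image g).card : ℝ) * MvPolynomial.X 1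
  else
    MvPolynomial.C (Fintype.card V : ℝ) - MvPolynomial.X 0 -
      MvPolynomial.C (((X.filter fun x' => g x' ∉ s).image g).card : ℝ) * MvPolynomial.X 2

theorem totalDegree_extensionPoly_le (g : V → V) (X s : Finset V) (x : V) :
    (extensionPoly g X s x).totalDegree ≤ 1 := by
  have hX : ∀ i : Fin 3, (MvPolynomial.X i : MvPolynomial (Fin 3) ℝ).totalDegree ≤ 1 := fun i =>
    (MvPolynomial.totalDegree_X i).le
  have hC : ∀ c : ℝ, (MvPolynomial.C c : MvPolynomial (Fin 3) ℝ).totalDegree ≤ 1 := fun c => by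
    rw [MvPolynomial.totalDegree_C]; exact zero_le_one
  have hCX : ∀ (c : ℝ) (i : Fin 3),
      (MvPolynomial.C c * MvPolynomial.X i : MvPolynomial (Fin 3) ℝ).totalDegree ≤ 1 := fun c i =>
    (MvPolynomial.totalDegree_mul _ _).trans (by simp [MvPolynomial.totalDegree_C])
  have hsub : ∀ p q : MvPolynomial (Fin 3) ℝ, p.totalDegree ≤ 1 → q.totalDegree ≤ 1 →
      (p - q).totalDegree ≤ 1 := fun p q hp hq =>
    (MvPolynomial.totalDegree_sub p q).trans (max_le hp hq)
  unfold extensionPoly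
  split_ifs
  · exact hsub _ _ (hX _) (hC _)
  · exact hsub _ _ (hX _) (hC _)
  · exact hsub _ _ (hX _) (hCX _ _)
  · exact hsub _ _ (hsub _ _ (hC _) (hX _)) (hCX _ _)

/-- The profile fixes the sizes of the fibres and of the preimage of `A`, while the numbers of
points and fibres already used depend only on `g`, `X` and `s`. Hence the count is affine in (m, a,
b). -/
theorem card_admissible_eq {f g : V → V} {A X s : Finset V} {m a b : ℕ} (hf : HasProfile f A m a b)
    {σ : Equiv.Perm V} (hσ : σ ∈ compatiblePerms f g A X s) (x : V) :
    (((Finset.univ.filter fun z => z ∉ X.image σ ∧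
      ((∀ x' ∈ X, f z = f (σ x') ↔ g x = g x') ∧ (f z ∈ A ↔ g x ∈ s))).card : ℕ) : ℝ) =
      MvPolynomial.eval ![(m : ℝ), a, b] (extensionPoly g X s x) := by
  obtain ⟨hfa, hfb, hfm⟩ := hf
  simp only [compatiblePerms, Finset.mem_filter, Finset.mem_univ, true_and] at hσ
  obtain ⟨hker, hlab⟩ := hσ
  by_cases hold : g x ∈ X.image g
  · obtain ⟨x0, hx0, hgx0⟩ := Finset.mem_image.mp hold
    have hset : (Finset.univ.filter fun z => z ∉ X.image σ ∧
        ((∀ x' ∈ X, f z = f (σ x') ↔ g x = g x') ∧ (f z ∈ A ↔ g x ∈ s))) =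
        (Finset.univ.filter fun z => f z = f (σ x0)) \
          (X.filter fun x' => g x' = g x).image σ := by
      ext z
      simp only [Finset.mem_filter, Finset.mem_univ, true_and, Finset.mem_sdiff, Finset.mem_image,
        not_exists, not_and]
      constructor
      · rintro ⟨h1, h2, -⟩
        exact ⟨(h2 x0 hx0).mpr hgx0.symm, fun x' hx' => h1 x' hx'.1⟩
      · rintro ⟨h1, h2⟩
        refine ⟨fun x' hx' hz => h2 x' ⟨hx', ?_⟩ hz, fun x' hx' => ?_, ?_⟩
        · rw [← hgx0, ← hker x' hx' x0 hx0, hz, h1]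
        · rw [h1, hker x0 hx0 x' hx', hgx0]
        · rw [h1, hlab x0 hx0, hgx0]
    have hsub : (X.filter fun x' => g x' = g x).image σ ⊆
        Finset.univ.filter fun z => f z = f (σ x0) := by
      intro z hz
      simp only [Finset.mem_image, Finset.mem_filter] at hz
      obtain ⟨x', ⟨hx', hg⟩, rfl⟩ := hz
      simp only [Finset.mem_filter, Finset.mem_univ, true_and]
      rw [hker x' hx' x0 hx0, hg, hgx0]
    rw [hset, Finset.card_sdiff_of_subset hsub, Nat.cast_sub (Finset.card_le_card hsub),
      Finset.card_image_of_injective _ σ.injective, extensionPoly, if_pos hold]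
    by_cases hs : g x ∈ s
    · rw [hfa (σ x0) (by rwa [hlab x0 hx0, hgx0])]
      simp [hs]
    · rw [hfb (σ x0) (by rwa [hlab x0 hx0, hgx0])]
      simp [hs]
  · have hne : ∀ x' ∈ X, g x ≠ g x' := fun x' hx' h =>
      hold (Finset.mem_image.mpr ⟨x', hx', h.symm⟩)
    rw [extensionPoly, if_neg hold]
    by_cases hs : g x ∈ s
    · set H := (X.filter fun x' => g x' ∈ s).image (fun x' => f (σ x')) with hH
      have hHA : ∀ y ∈ H, y ∈ A := by
        intro y hy
        simp only [hH, Finset.mem_image, Finset.mem_filter] at hy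
        obtain ⟨x', ⟨hx', hg⟩, rfl⟩ := hy
        exact (hlab x' hx').mpr hg
      have hHa : ∀ y ∈ H, (Finset.univ.filter fun z => f z = y).card = a := by
        intro y hy
        have hyA := hHA y hy
        simp only [hH, Finset.mem_image, Finset.mem_filter] at hy
        obtain ⟨x', -, rfl⟩ := hy
        exact hfa _ hyA
      have hHc : H.card = ((X.filter fun x' => g x' ∈ s).image g).card :=
        card_image_eq_of_kernel_eq fun x1 h1 x2 h2 =>
          hker x1 (Finset.mem_of_mem_filter _ h1) x2 (Finset.mem_of_mem_filter _ h2)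
      have hset : (Finset.univ.filter fun z => z ∉ X.image σ ∧
          ((∀ x' ∈ X, f z = f (σ x') ↔ g x = g x') ∧ (f z ∈ A ↔ g x ∈ s))) =
          (Finset.univ.filter fun z => f z ∈ A) \ (Finset.univ.filter fun z => f z ∈ H) := by
        ext z
        simp only [Finset.mem_filter, Finset.mem_univ, true_and, Finset.mem_sdiff, hs, iff_true]
        constructor
        · rintro ⟨-, h2, h3⟩
          refine ⟨h3, fun hzH => ?_⟩
          obtain ⟨x', hx', hz⟩ := Finset.mem_image.mp hzH
          have hx' := Finset.mem_of_mem_filter _ hx'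
          exact hne x' hx' ((h2 x' hx').mp hz.symm)
        · rintro ⟨h1, h2⟩
          have hno : ∀ x' ∈ X, f z ≠ f (σ x') := fun x' hx' hz =>
            h2 (Finset.mem_image.mpr ⟨x', Finset.mem_filter.mpr ⟨hx', (hlab x' hx').mp (hz ▸ h1)⟩,
              hz.symm⟩)
          refine ⟨fun hz => ?_, fun x' hx' => iff_of_false (hno x' hx') (hne x' hx'), h1⟩
          obtain ⟨x', hx', rfl⟩ := Finset.mem_image.mp hz
          exact hno x' hx' rfl
      have hsub : (Finset.univ.filter fun z => f z ∈ H) ⊆ Finset.univ.filter fun z => f z ∈ A := by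
        intro z hz
        simp only [Finset.mem_filter, Finset.mem_univ, true_and] at hz ⊢
        exact hHA _ hz
      rw [hset, Finset.card_sdiff_of_subset hsub, Nat.cast_sub (Finset.card_le_card hsub), hfm,
        card_preimage_eq_mul hHa, hHc]
      simp [hs]
    · set H := (X.filter fun x' => g x' ∉ s).image (fun x' => f (σ x')) with hH
      have hHA : ∀ y ∈ H, y ∉ A := by
        intro y hy
        simp only [hH, Finset.mem_image, Finset.mem_filter] at hy
        obtain ⟨x', ⟨hx', hg⟩, rfl⟩ := hy
        rwa [hlab x' hx']
      have hHa : ∀ y ∈ H, (Finset.univ.filter fun z => f z = y).card = b := by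
        intro y hy
        have hyA := hHA y hy
        simp only [hH, Finset.mem_image, Finset.mem_filter] at hy
        obtain ⟨x', -, rfl⟩ := hy
        exact hfb _ hyA
      have hHc : H.card = ((X.filter fun x' => g x' ∉ s).image g).card :=
        card_image_eq_of_kernel_eq fun x1 h1 x2 h2 =>
          hker x1 (Finset.mem_of_mem_filter _ h1) x2 (Finset.mem_of_mem_filter _ h2)
      have hset : (Finset.univ.filter fun z => z ∉ X.image σ ∧
          ((∀ x' ∈ X, f z = f (σ x') ↔ g x = g x') ∧ (f z ∈ A ↔ g x ∈ s))) =
          (Finset.univ.filter fun z => f z ∈ A)ᶜ \ (Finset.univ.filter fun z => f z ∈ H) := by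
        ext z
        simp only [Finset.mem_filter, Finset.mem_univ, true_and, Finset.mem_sdiff, hs, iff_false,
          Finset.mem_compl]
        constructor
        · rintro ⟨-, h2, h3⟩
          refine ⟨h3, fun hzH => ?_⟩
          obtain ⟨x', hx', hz⟩ := Finset.mem_image.mp hzH
          have hx' := Finset.mem_of_mem_filter _ hx'
          exact hne x' hx' ((h2 x' hx').mp hz.symm)
        · rintro ⟨h1, h2⟩
          have hno : ∀ x' ∈ X, f z ≠ f (σ x') := fun x' hx' hz =>
            h2 (Finset.mem_image.mpr ⟨x', Finset.mem_filter.mpr ⟨hx', by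
              rwa [← hlab x' hx', ← hz]⟩, hz.symm⟩)
          refine ⟨fun hz => ?_, fun x' hx' => iff_of_false (hno x' hx') (hne x' hx'), h1⟩
          obtain ⟨x', hx', rfl⟩ := Finset.mem_image.mp hz
          exact hno x' hx' rfl
      have hsub : (Finset.univ.filter fun z => f z ∈ H) ⊆
          (Finset.univ.filter fun z => f z ∈ A)ᶜ := by
        intro z hz
        simp only [Finset.mem_filter, Finset.mem_univ, true_and, Finset.mem_compl] at hz ⊢
        exact hHA _ hz
      rw [hset, Finset.card_sdiff_of_subset hsub, Nat.cast_sub (Finset.card_le_card hsub),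
        Finset.card_compl, Nat.cast_sub (Finset.card_le_univ _), hfm,
        card_preimage_eq_mul hHa, hHc]
      simp [hs]

end Symmetrization

section Symmetrization

variable {V : Type*} [DecidableEq V]

/-- Equal kernels make h x ↦ g x a well-defined injection between the images of `X`; it is extended
to a permutation one point at a time, by a transposition whenever a new value appears. -/
theorem exists_perm_apply_eq {h g : V → V} {X : Finset V}
    (hker : ∀ x ∈ X, ∀ x' ∈ X, h x = h x' ↔ g x = g x') :
    ∃ π : Equiv.Perm V, ∀ x ∈ X, π (h x) = g x := by
  induction X using Finset.induction_on with
  | empty => exact ⟨1, by simp⟩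
  | insert x X hx ih =>
    obtain ⟨π, hπ⟩ := ih fun x1 h1 x2 h2 =>
      hker x1 (Finset.mem_insert_of_mem h1) x2 (Finset.mem_insert_of_mem h2)
    have hk : ∀ x' ∈ X, h x' = h x ↔ g x' = g x := fun x' hx' =>
      hker x' (Finset.mem_insert_of_mem hx') x (Finset.mem_insert_self _ _)
    by_cases hold : ∃ x' ∈ X, h x' = h x
    · obtain ⟨x', hx', hh⟩ := hold
      refine ⟨π, (Finset.forall_mem_insert _ _ _).mpr ⟨?_, hπ⟩⟩
      rw [← hh, hπ x' hx', (hk x' hx').mp hh]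
    · push Not at hold
      refine ⟨Equiv.swap (π (h x)) (g x) * π, (Finset.forall_mem_insert _ _ _).mpr ⟨?_, ?_⟩⟩
      · simp
      · intro x' hx'
        rw [Equiv.Perm.mul_apply, Equiv.swap_apply_of_ne_of_ne, hπ x' hx']
        · exact fun hc => hold x' hx' (π.injective hc)
        · rw [hπ x' hx']
          exact fun hc => hold x' hx' ((hk x' hx').mpr hc)

variable [Fintype V]

/-- Each point added to `X` multiplies the count by `extensionPoly` divided by |V| - |X|. The
denominator does not involve `f`, so the degree grows by at most one per point. -/
theorem exists_poly_card_compatiblePerms (g : V → V) (s X : Finset V) :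
    ∃ Q : MvPolynomial (Fin 3) ℝ, Q.totalDegree ≤ X.card ∧
      ∀ (f : V → V) (A : Finset V) (m a b : ℕ), HasProfile f A m a b →
        ((compatiblePerms f g A X s).card : ℝ) = MvPolynomial.eval ![(m : ℝ), a, b] Q := by
  induction X using Finset.induction_on with
  | empty =>
    refine ⟨MvPolynomial.C (Fintype.card (Equiv.Perm V) : ℝ), (MvPolynomial.totalDegree_C _).le, ?_⟩
    intro f A m a b _
    simp [compatiblePerms]
  | insert x X hx ih =>
    obtain ⟨Q, hQ, hcard⟩ := ih
    have hpos : (0 : ℝ) < (Fintype.card V : ℝ) - X.card := by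
      rw [sub_pos, Nat.cast_lt]
      exact Finset.card_lt_univ_of_notMem hx
    refine ⟨MvPolynomial.C ((Fintype.card V : ℝ) - X.card)⁻¹ * (extensionPoly g X s x * Q), ?_, ?_⟩
    · rw [Finset.card_insert_of_notMem hx]
      have h1 := MvPolynomial.totalDegree_mul (MvPolynomial.C ((Fintype.card V : ℝ) - X.card)⁻¹)
        (extensionPoly g X s x * Q)
      have h2 := MvPolynomial.totalDegree_mul (extensionPoly g X s x) Q
      have h3 := totalDegree_extensionPoly_le g X s x
      rw [MvPolynomial.totalDegree_C] at h1
      omega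
    · intro f A m a b hf
      have hswap : ∀ z ∉ X, ∀ x' ∈ X, Equiv.swap x z x' = x' := fun z hz x' hx' =>
        Equiv.swap_apply_of_ne_of_ne (fun h => hx (h ▸ hx')) (fun h => hz (h ▸ hx'))
      have h := card_filter_perm_mul (W := compatiblePerms f g A X s) (X := X) (x := x)
        (R := fun σ z => (∀ x' ∈ X, f z = f (σ x') ↔ g x = g x') ∧ (f z ∈ A ↔ g x ∈ s))
        (by
          intro z hz σ
          simp only [compatiblePerms, Finset.mem_filter, Finset.mem_univ, true_and,
            Equiv.Perm.mul_apply]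
          refine and_congr (forall₂_congr fun x1 h1 => forall₂_congr fun x2 h2 => ?_)
            (forall₂_congr fun x1 h1 => ?_)
          · rw [hswap z hz x1 h1, hswap z hz x2 h2]
          · rw [hswap z hz x1 h1])
        (by
          intro z hz σ y
          simp only [Equiv.Perm.mul_apply]
          refine and_congr_left fun _ => forall₂_congr fun x1 h1 => ?_
          rw [hswap z hz x1 h1])
        (fun σ hσ => card_admissible_eq hf hσ x)
      have hins : compatiblePerms f g A (insert x X) s = (compatiblePerms f g A X s).filter
          fun σ => (∀ x' ∈ X, f (σ x) = f (σ x') ↔ g x = g x') ∧ (f (σ x) ∈ A ↔ g x ∈ s) := by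
        ext σ
        simp only [compatiblePerms, Finset.mem_filter, Finset.mem_univ, true_and,
          Finset.forall_mem_insert]
        constructor
        · rintro ⟨⟨h1, h2⟩, h3, h4⟩
          exact ⟨⟨fun x1 hx1 => (h2 x1 hx1).2, h4⟩, h1, h3⟩
        · rintro ⟨⟨h1, h2⟩, h3, h4⟩
          exact ⟨⟨h3, fun x1 hx1 => ⟨eq_comm.trans ((h3 x1 hx1).trans eq_comm),
            h1 x1 hx1⟩⟩, h4, h2⟩
      rw [hins, map_mul, map_mul, MvPolynomial.eval_C, ← hcard f A m a b hf, ← h,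
        inv_mul_cancel_left₀ hpos.ne']

/-- The solutions, if any, form a coset of the pointwise stabiliser of g(X), so their number depends
on `h` only through its kernel on `X`. -/
theorem card_perm_apply_eq (h g : V → V) (X : Finset V) :
    (Finset.univ.filter fun τ : Equiv.Perm V => ∀ x ∈ X, τ (h x) = g x).card =
      if ∀ x ∈ X, ∀ x' ∈ X, h x = h x' ↔ g x = g x' then
        (Finset.univ.filter fun τ : Equiv.Perm V => ∀ x ∈ X, τ (g x) = g x).card else 0 := by
  split_ifs with hker
  · obtain ⟨π, hπ⟩ := exists_perm_apply_eq hker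
    refine Finset.card_bij' (fun τ _ => τ * π⁻¹) (fun τ _ => τ * π) ?_ ?_ ?_ ?_
    · intro τ hτ
      simp only [Finset.mem_filter, Finset.mem_univ, true_and] at hτ ⊢
      intro x hx
      rw [Equiv.Perm.mul_apply, ← hπ x hx, ← Equiv.Perm.mul_apply π⁻¹, inv_mul_cancel,
        Equiv.Perm.one_apply, hτ x hx, hπ x hx]
    · intro τ hτ
      simp only [Finset.mem_filter, Finset.mem_univ, true_and] at hτ ⊢
      intro x hx
      rw [Equiv.Perm.mul_apply, hπ x hx, hτ x hx]
    · intro τ _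
      simp
    · intro τ _
      simp
  · rw [Finset.card_eq_zero, Finset.filter_eq_empty_iff]
    intro τ _ hτ
    refine hker fun x hx x' hx' => ?_
    rw [← hτ x hx, ← hτ x' hx', τ.injective.eq_iff]

/-- The indicator function of the functions that agree with `g` on `X`. -/
noncomputable def agreeIndicator (X : Finset V) (g f : V → V) : ℝ :=
  if ∀ x ∈ X, f x = g x then 1 else 0

/-- The functionals on `V → V` that are polynomials of degree at most `d` in the indicators of
`f x = y`. -/
noncomputable def degreeLE (V : Type*) [DecidableEq V] [Fintype V] (d : ℕ) :
    Submodule ℝ ((V → V) → ℝ) :=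
  Submodule.span ℝ {p | ∃ (X : Finset V) (g : V → V), X.card ≤ d ∧ p = agreeIndicator X g}

/-- Each σ with the right kernel is compatible with exactly one `s`: the values of `g` at those x ∈
X for which f (σ x) ∈ A. -/
theorem sum_card_compatiblePerms (f g : V → V) (A X : Finset V) :
    ∑ s ∈ (X.image g).powerset, (compatiblePerms f g A X s).card =
      (Finset.univ.filter fun σ : Equiv.Perm V =>
        ∀ x ∈ X, ∀ x' ∈ X, f (σ x) = f (σ x') ↔ g x = g x').card := by
  rw [← Finset.card_biUnion]
  · congr 1
    ext σ
    simp only [compatiblePerms, Finset.mem_biUnion, Finset.mem_powerset, Finset.mem_filter,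
      Finset.mem_univ, true_and]
    constructor
    · rintro ⟨s, -, h, -⟩
      exact h
    · intro h
      refine ⟨(X.filter fun x => f (σ x) ∈ A).image g,
        Finset.image_subset_image (Finset.filter_subset _ _), h, fun x hx => ?_⟩
      rw [Finset.mem_image]
      constructor
      · exact fun hA => ⟨x, Finset.mem_filter.mpr ⟨hx, hA⟩, rfl⟩
      · rintro ⟨x', hx', hg⟩
        rw [Finset.mem_filter] at hx'
        rw [(h x hx x' hx'.1).mpr hg.symm]
        exact hx'.2
  · intro s hs s' hs' hne
    rw [Function.onFun, Finset.disjoint_left]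
    intro σ hσ hσ'
    apply hne
    simp only [compatiblePerms, Finset.mem_filter, Finset.mem_univ, true_and] at hσ hσ'
    rw [Finset.mem_coe, Finset.mem_powerset] at hs hs'
    ext y
    constructor
    · intro hy
      obtain ⟨x, hx, rfl⟩ := Finset.mem_image.mp (hs hy)
      rwa [← hσ'.2 x hx, hσ.2 x hx]
    · intro hy
      obtain ⟨x, hx, rfl⟩ := Finset.mem_image.mp (hs' hy)
      rwa [← hσ.2 x hx, hσ'.2 x hx]

theorem sum_perm_agreeIndicator (f g : V → V) (A X : Finset V) :
    ∑ σ : Equiv.Perm V, ∑ τ : Equiv.Perm V, agreeIndicator X g (fun x => τ (f (σ x))) =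
      (Finset.univ.filter fun τ : Equiv.Perm V => ∀ x ∈ X, τ (g x) = g x).card *
        ∑ s ∈ (X.image g).powerset, ((compatiblePerms f g A X s).card : ℝ) := by
  have h1 : ∀ σ : Equiv.Perm V,
      ∑ τ : Equiv.Perm V, agreeIndicator X g (fun x => τ (f (σ x))) =
      if ∀ x ∈ X, ∀ x' ∈ X, f (σ x) = f (σ x') ↔ g x = g x' then
        ((Finset.univ.filter fun τ : Equiv.Perm V => ∀ x ∈ X, τ (g x) = g x).card : ℝ)
      else 0 := by
    intro σ
    simp only [agreeIndicator]
    rw [Finset.sum_boole, card_perm_apply_eq (fun x => f (σ x)) g X]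
    push_cast
    rfl
  rw [Finset.sum_congr rfl fun σ _ => h1 σ, ← Finset.sum_filter, Finset.sum_const, nsmul_eq_mul,
    ← sum_card_compatiblePerms f g A X, mul_comm, Nat.cast_sum]

/-- Averaging a functional of degree `d` over all relabellings of the inputs and the outputs of `f`
gives a polynomial of degree `d` in the parameters of a profile of `f`. -/
theorem exists_poly_sum_perm {d : ℕ} {p : (V → V) → ℝ} (hp : p ∈ degreeLE V d) :
    ∃ Q : MvPolynomial (Fin 3) ℝ, Q.totalDegree ≤ d ∧
      ∀ (f : V → V) (A : Finset V) (m a b : ℕ), HasProfile f A m a b →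
        ∑ σ : Equiv.Perm V, ∑ τ : Equiv.Perm V, p (fun x => τ (f (σ x))) =
          MvPolynomial.eval ![(m : ℝ), a, b] Q := by
  induction hp using Submodule.span_induction with
  | mem p hp =>
    obtain ⟨X, g, hX, rfl⟩ := hp
    choose Q hQ hcard using fun s => exists_poly_card_compatiblePerms g s X
    refine ⟨MvPolynomial.C ((Finset.univ.filter fun τ : Equiv.Perm V =>
      ∀ x ∈ X, τ (g x) = g x).card : ℝ) * ∑ s ∈ (X.image g).powerset, Q s, ?_, ?_⟩
    · refine (MvPolynomial.totalDegree_mul _ _).trans ?_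
      rw [MvPolynomial.totalDegree_C, zero_add]
      exact MvPolynomial.totalDegree_finsetSum_le fun s _ => (hQ s).trans hX
    · intro f A m a b hf
      rw [sum_perm_agreeIndicator f g A X, map_mul, MvPolynomial.eval_C, map_sum]
      congr 1
      exact Finset.sum_congr rfl fun s _ => hcard s f A m a b hf
  | zero => exact ⟨0, by simp, by intros; simp⟩
  | add p q _ _ ihp ihq =>
    obtain ⟨P, hP, hP'⟩ := ihp
    obtain ⟨Q, hQ, hQ'⟩ := ihq
    refine ⟨P + Q, (MvPolynomial.totalDegree_add P Q).trans (max_le hP hQ), ?_⟩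
    intro f A m a b hf
    rw [map_add, ← hP' f A m a b hf, ← hQ' f A m a b hf]
    simp only [Pi.add_apply, Finset.sum_add_distrib]
  | smul c p _ ih =>
    obtain ⟨P, hP, hP'⟩ := ih
    refine ⟨MvPolynomial.C c * P, ?_, ?_⟩
    · refine (MvPolynomial.totalDegree_mul _ _).trans ?_
      rw [MvPolynomial.totalDegree_C, zero_add]
      exact hP
    · intro f A m a b hf
      rw [map_mul, MvPolynomial.eval_C, ← hP' f A m a b hf]
      simp only [Pi.smul_apply, smul_eq_mul, Finset.mul_sum]

end Symmetrization

theorem sum_sum_perm_eq {V : Type*} {S : Finset (V → V)}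
    (hS : ∀ f ∈ S, ∀ σ τ : Equiv.Perm V, (fun x => τ (f (σ x))) ∈ S) (p : (V → V) → ℝ)
    (σ τ : Equiv.Perm V) : ∑ f ∈ S, p (fun x => τ (f (σ x))) = ∑ f ∈ S, p f := by
  refine Finset.sum_bij' (fun f _ x => τ (f (σ x))) (fun f _ x => τ⁻¹ (f (σ⁻¹ x)))
    (fun f hf => hS f hf σ τ) (fun f hf => hS f hf σ⁻¹ τ⁻¹) ?_ ?_ (fun _ _ => rfl)
  · intro f _; ext x; simp
  · intro f _; ext x; simp

section Symmetrization

variable {V : Type*} [Fintype V] [DecidableEq V]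

theorem agreeIndicator_mem_degreeLE {d : ℕ} {X : Finset V} (hX : X.card ≤ d) (g : V → V) :
    agreeIndicator X g ∈ degreeLE V d :=
  Submodule.subset_span ⟨X, g, hX, rfl⟩

theorem degreeLE_mono {d e : ℕ} (h : d ≤ e) : degreeLE V d ≤ degreeLE V e :=
  Submodule.span_mono fun _ ⟨X, g, hX, hp⟩ => ⟨X, g, hX.trans h, hp⟩

theorem const_mem_degreeLE (d : ℕ) (c : ℝ) : (fun _ => c) ∈ degreeLE V d := by
  have h : (fun _ : V → V => c) = c • agreeIndicator (∅ : Finset V) id := by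
    ext f; simp [agreeIndicator]
  rw [h]
  exact Submodule.smul_mem _ _ (agreeIndicator_mem_degreeLE (by simp) _)

/-- Two partial assignments either glue to one on the union or contradict each other, and then the
product vanishes. -/
theorem agreeIndicator_mul_mem_degreeLE {d e : ℕ} {X Y : Finset V} (hX : X.card ≤ d)
    (hY : Y.card ≤ e) (g h : V → V) :
    agreeIndicator X g * agreeIndicator Y h ∈ degreeLE V (d + e) := by
  by_cases hc : ∀ x ∈ X, x ∈ Y → g x = h x
  · have heq : agreeIndicator X g * agreeIndicator Y h =
        agreeIndicator (X ∪ Y) (fun x => if x ∈ X then g x else h x) := by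
      ext f
      have hiff : (∀ x ∈ X ∪ Y, f x = if x ∈ X then g x else h x) ↔
          (∀ x ∈ X, f x = g x) ∧ ∀ x ∈ Y, f x = h x := by
        constructor
        · intro H
          refine ⟨fun x hx => ?_, fun x hx => ?_⟩
          · simpa [hx] using H x (Finset.mem_union_left _ hx)
          · have := H x (Finset.mem_union_right _ hx)
            split_ifs at this with hxX
            · rw [this, hc x hxX hx]
            · exact this
        · rintro ⟨H1, H2⟩ x hx
          split_ifs with hxX
          · exact H1 x hxX
          · exact H2 x ((Finset.mem_union.mp hx).resolve_left hxX)
      simp only [Pi.mul_apply, agreeIndicator, hiff, ite_and, mul_ite, mul_one, mul_zero]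
      split_ifs <;> rfl
    rw [heq]
    exact agreeIndicator_mem_degreeLE ((Finset.card_union_le X Y).trans (add_le_add hX hY)) _
  · have heq : agreeIndicator X g * agreeIndicator Y h = 0 := by
      push Not at hc
      obtain ⟨x, hxX, hxY, hne⟩ := hc
      ext f
      simp only [Pi.mul_apply, agreeIndicator, Pi.zero_apply, mul_eq_zero, ite_eq_right_iff,
        one_ne_zero, imp_false]
      by_contra! H
      exact hne ((H.1 x hxX).symm.trans (H.2 x hxY))
    rw [heq]
    exact Submodule.zero_mem _

theorem mul_mem_degreeLE {d e : ℕ} {p q : (V → V) → ℝ} (hp : p ∈ degreeLE V d)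
    (hq : q ∈ degreeLE V e) : p * q ∈ degreeLE V (d + e) := by
  have h := Submodule.mul_mem_mul hp hq
  rw [degreeLE, degreeLE, Submodule.span_mul_span] at h
  refine Submodule.span_le.mpr ?_ h
  rintro _ ⟨_, ⟨X, g, hX, rfl⟩, _, ⟨Y, k, hY, rfl⟩, rfl⟩
  exact agreeIndicator_mul_mem_degreeLE hX hY g k

/-- The averages of a functional of degree `d` over classes of functions that are invariant under
relabelling are given by a polynomial of degree `d` in the parameters of the profiles. -/
theorem exists_poly_average {d : ℕ} {p : (V → V) → ℝ} (hp : p ∈ degreeLE V d)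
    (hp0 : ∀ f, 0 ≤ p f) (hp1 : ∀ f, p f ≤ 1) :
    ∃ Q : MvPolynomial (Fin 3) ℝ, Q.totalDegree ≤ d ∧
      (∀ (f : V → V) (A : Finset V) (m a b : ℕ), HasProfile f A m a b →
        MvPolynomial.eval ![(m : ℝ), a, b] Q ∈ Set.Icc (0 : ℝ) 1) ∧
      ∀ S : Finset (V → V), (∀ f ∈ S, ∀ σ τ : Equiv.Perm V, (fun x => τ (f (σ x))) ∈ S) →
        ∀ m a b : ℕ, (∀ f ∈ S, ∃ A, HasProfile f A m a b) →
          ∑ f ∈ S, p f = S.card * MvPolynomial.eval ![(m : ℝ), a, b] Q := by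
  obtain ⟨Q, hQ, hQe⟩ := exists_poly_sum_perm hp
  set N : ℝ := (Fintype.card (Equiv.Perm V) : ℝ) with hN
  have hN0 : 0 < N := by rw [hN]; exact_mod_cast Fintype.card_pos
  refine ⟨MvPolynomial.C (N * N)⁻¹ * Q, ?_, ?_, ?_⟩
  · refine (MvPolynomial.totalDegree_mul _ _).trans ?_
    rw [MvPolynomial.totalDegree_C, zero_add]
    exact hQ
  · intro f A m a b hf
    rw [map_mul, MvPolynomial.eval_C, ← hQe f A m a b hf]
    constructor
    · have := Finset.sum_nonneg fun (σ : Equiv.Perm V) (_ : σ ∈ Finset.univ) =>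
        Finset.sum_nonneg fun (τ : Equiv.Perm V) (_ : τ ∈ Finset.univ) =>
          hp0 (fun x => τ (f (σ x)))
      positivity
    · rw [inv_mul_le_one₀ (by positivity)]
      calc ∑ σ : Equiv.Perm V, ∑ τ : Equiv.Perm V, p (fun x => τ (f (σ x)))
          ≤ ∑ σ : Equiv.Perm V, ∑ τ : Equiv.Perm V, (1 : ℝ) :=
            Finset.sum_le_sum fun σ _ => Finset.sum_le_sum fun τ _ => hp1 _
        _ = N * N := by simp [hN]
  · intro S hS m a b hf
    have h1 : ∑ f ∈ S, ∑ σ : Equiv.Perm V, ∑ τ : Equiv.Perm V, p (fun x => τ (f (σ x))) =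
        S.card * MvPolynomial.eval ![(m : ℝ), a, b] Q := by
      rw [← nsmul_eq_mul, ← Finset.sum_const]
      refine Finset.sum_congr rfl fun f hfS => ?_
      obtain ⟨A, hA⟩ := hf f hfS
      exact hQe f A m a b hA
    have h2 : ∑ f ∈ S, ∑ σ : Equiv.Perm V, ∑ τ : Equiv.Perm V, p (fun x => τ (f (σ x))) =
        N * N * ∑ f ∈ S, p f := by
      rw [Finset.sum_comm]
      simp_rw [Finset.sum_comm (s := S), sum_sum_perm_eq hS p]
      simp [hN, mul_assoc]
    rw [map_mul, MvPolynomial.eval_C, mul_left_comm, ← h1, h2, inv_mul_cancel_left₀ (by positivity)]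

end Symmetrization

/-! ### Functions realising prescribed profiles. -/

section Profiles

variable {n : ℕ}

theorem card_fiber_of_isRToOne {r : ℕ} {f : Fin n → Fin n} (hf : IsRToOne r f) (x : Fin n) :
    (Finset.univ.filter fun z => f z = f x).card = r := by
  rw [← hf (f x) ⟨x, rfl⟩, ← Set.ncard_coe_finset]
  congr 1
  ext z
  simp

theorem isRToOne_one_iff {f : Fin n → Fin n} : IsRToOne 1 f ↔ Function.Injective f := by
  constructor
  · intro h x y hxy
    obtain ⟨z, hz⟩ := Set.ncard_eq_one.mp (h (f x) ⟨x, rfl⟩)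
    have h1 : x ∈ f ⁻¹' {f x} := rfl
    have h2 : y ∈ f ⁻¹' {f x} := hxy.symm
    rw [hz] at h1 h2
    exact h1.trans h2.symm
  · rintro h _ ⟨x, rfl⟩
    rw [Set.ncard_eq_one]
    exact ⟨x, by ext z; simp [h.eq_iff]⟩

/-- Any m / r values of `f` can serve as `A`. This freedom in `m` lets the one-to-one and the
`r`-to-one functions be compared at the same `m`. -/
theorem exists_hasProfile_of_isRToOne {r m : ℕ} {f : Fin n → Fin n} (hf : IsRToOne r f)
    (hr : 0 < r) (hm : r ∣ m) (hmn : m ≤ n) : ∃ A, HasProfile f A m r r := by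
  have hfib := card_fiber_of_isRToOne hf
  have himg : ∀ y ∈ Finset.univ.image f, (Finset.univ.filter fun z => f z = y).card = r := by
    intro y hy
    obtain ⟨x, -, rfl⟩ := Finset.mem_image.mp hy
    exact hfib x
  obtain ⟨k, rfl⟩ := hm
  have hcard : n = (Finset.univ.image f).card * r := by
    rw [← card_preimage_eq_mul himg]
    simp
  obtain ⟨A, hA, hAk⟩ := Finset.exists_subset_card_eq (s := Finset.univ.image f) (n := k) (by
    refine Nat.le_of_mul_le_mul_right ?_ hr
    rw [← hcard, mul_comm]; exact hmn)
  refine ⟨A, fun x _ => hfib x, fun x _ => hfib x, ?_⟩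
  rw [card_preimage_eq_mul fun y hy => himg y (hA hy), hAk, mul_comm]

theorem card_filter_fin_eq_of_Ico {l u : ℕ} (hu : u ≤ n) {P : Fin n → Prop} [DecidablePred P]
    (hP : ∀ z : Fin n, P z ↔ l ≤ z ∧ (z : ℕ) < u) : (Finset.univ.filter P).card = u - l := by
  rw [← Nat.card_Ico]
  refine Finset.card_bij (fun z _ => (z : ℕ)) ?_ ?_ ?_
  · intro z hz
    rw [Finset.mem_filter] at hz
    rw [Finset.mem_Ico]
    exact (hP z).mp hz.2
  · intro z _ w _ h
    exact Fin.ext h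
  · intro k hk
    rw [Finset.mem_Ico] at hk
    exact ⟨⟨k, hk.2.trans_le hu⟩, by simpa [hP] using hk, rfl⟩

theorem mul_div_eq_iff_mem_Ico {a x z : ℕ} (ha : 0 < a) :
    a * (z / a) = a * (x / a) ↔ a * (x / a) ≤ z ∧ z < a * (x / a) + a := by
  have h1 := Nat.div_add_mod z a
  have h2 := Nat.mod_lt z ha
  constructor
  · intro h
    omega
  · rintro ⟨h3, h4⟩
    congr 1
    rw [Nat.div_eq_iff ha]
    rw [mul_comm] at h3 h4
    omega

theorem exists_hasProfile {m a b : ℕ} (ha : 0 < a) (hb : 0 < b) (hmn : m ≤ n) (ham : a ∣ m)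
    (hbm : b ∣ n - m) : ∃ (f : Fin n → Fin n) (A : Finset (Fin n)), HasProfile f A m a b := by
  -- Cut [0, m) into blocks of length `a` and [m, n) into blocks of length `b`, and send each point
  -- to the left end of its block.
  set φ : ℕ → ℕ := fun x => if x < m then a * (x / a) else m + b * ((x - m) / b) with hφ
  have hφx : ∀ x, φ x ≤ x := by
    intro x
    have h1 := Nat.mul_div_le x a
    have h2 := Nat.mul_div_le (x - m) b
    simp only [hφ]
    split_ifs <;> omega
  have hφm : ∀ x, φ x < m ↔ x < m := by
    intro x
    have h1 := Nat.mul_div_le x a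
    simp only [hφ]
    split_ifs <;> omega
  have hcell : ∀ {c k y : ℕ}, 0 < c → c ∣ k → y < k → c * (y / c) + c ≤ k := by
    rintro c k y hc ⟨j, rfl⟩ hy
    have := Nat.div_lt_of_lt_mul hy
    nlinarith
  refine ⟨fun x => ⟨φ x, (hφx x).trans_lt x.2⟩, Finset.univ.filter fun y => (y : ℕ) < m, ?_, ?_, ?_⟩
  · intro x hx
    have hx : (x : ℕ) < m := by simpa [hφm] using hx
    have hc := hcell ha ham hx
    rw [card_filter_fin_eq_of_Ico (l := a * (x / a)) (u := a * (x / a) + a) (hc.trans hmn)]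
    · omega
    · intro z
      rw [Fin.mk.injEq, ← mul_div_eq_iff_mem_Ico ha]
      have h1 := Nat.mul_div_le (x : ℕ) a
      simp only [hφ, hx, if_true]
      split_ifs with hz
      · rfl
      · constructor
        · intro h; omega
        · intro h
          have := (mul_div_eq_iff_mem_Ico ha).mp h
          omega
  · intro x hx
    have hx : ¬ (x : ℕ) < m := by simpa [hφm] using hx
    have hc := hcell hb hbm (y := (x : ℕ) - m) (by omega)
    rw [card_filter_fin_eq_of_Ico (l := m + b * ((x - m) / b)) (u := m + b * ((x - m) / b) + b)
      (by omega)]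
    · omega
    · intro z
      rw [Fin.mk.injEq]
      have h1 := Nat.mul_div_le (z : ℕ) a
      have h2 := mul_div_eq_iff_mem_Ico (x := (x : ℕ) - m) (z := (z : ℕ) - m) hb
      simp only [hφ, hx, if_false]
      split_ifs with hz <;> omega
  · rw [card_filter_fin_eq_of_Ico (l := 0) (u := m) hmn]
    · omega
    · intro z
      simp [hφm]

end Profiles

end XorCollision

/-! ### Amplitudes of a query algorithm as polynomials in the oracle. -/

namespace XorCollision

section Amplitudes

variable {n q a : ℕ} {eIn eOut : Fin n ↪ Bits q}

theorem bxor_bxor_cancel (y z : Bits q) : bxor (bxor y z) z = y := by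
  ext k; simp [bxor]

theorem oracleMap_oracleMap (f : Fin n → Fin n) (b : RegBasis q a) :
    oracleMap eIn eOut f (oracleMap eIn eOut f b) = b := by
  simp [oracleMap, bxor_bxor_cancel]

theorem oracle_mulVec_apply (f : Fin n → Fin n) (v : RegBasis q a → ℂ) (b : RegBasis q a) :
    (oracle eIn eOut f a).mulVec v b = v (oracleMap eIn eOut f b) := by
  have h : ∀ b' : RegBasis q a, b = oracleMap eIn eOut f b' ↔ oracleMap eIn eOut f b = b' := by
    intro b'
    constructor
    · rintro rfl; exact oracleMap_oracleMap f b'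
    · rintro rfl; exact (oracleMap_oracleMap f b).symm
  simp [Matrix.mulVec, dotProduct, oracle, h]

/-- The real and imaginary parts have degree at most `d`. -/
def HasDegreeLE (d : ℕ) (ψ : (Fin n → Fin n) → ℂ) : Prop :=
  (fun f => (ψ f).re) ∈ degreeLE (Fin n) d ∧ (fun f => (ψ f).im) ∈ degreeLE (Fin n) d

theorem HasDegreeLE.const (d : ℕ) (c : ℂ) : HasDegreeLE d (fun _ : Fin n → Fin n => c) :=
  ⟨const_mem_degreeLE d _, const_mem_degreeLE d _⟩

theorem HasDegreeLE.mono {d e : ℕ} (h : d ≤ e) {ψ : (Fin n → Fin n) → ℂ} (hψ : HasDegreeLE d ψ) :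
    HasDegreeLE e ψ :=
  ⟨degreeLE_mono h hψ.1, degreeLE_mono h hψ.2⟩

theorem HasDegreeLE.mul {d e : ℕ} {ψ χ : (Fin n → Fin n) → ℂ} (hψ : HasDegreeLE d ψ)
    (hχ : HasDegreeLE e χ) : HasDegreeLE (d + e) (fun f => ψ f * χ f) := by
  constructor
  · simp only [Complex.mul_re]
    exact Submodule.sub_mem _ (mul_mem_degreeLE hψ.1 hχ.1) (mul_mem_degreeLE hψ.2 hχ.2)
  · simp only [Complex.mul_im]
    exact Submodule.add_mem _ (mul_mem_degreeLE hψ.1 hχ.2) (mul_mem_degreeLE hψ.2 hχ.1)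

theorem HasDegreeLE.sum {ι : Type*} {s : Finset ι} {d : ℕ} {ψ : ι → (Fin n → Fin n) → ℂ}
    (hψ : ∀ i ∈ s, HasDegreeLE d (ψ i)) : HasDegreeLE d (fun f => ∑ i ∈ s, ψ i f) := by
  constructor
  · have h : (fun f => (∑ i ∈ s, ψ i f).re) = ∑ i ∈ s, fun f => (ψ i f).re := by
      ext f; simp
    rw [h]
    exact Submodule.sum_mem _ fun i hi => (hψ i hi).1
  · have h : (fun f => (∑ i ∈ s, ψ i f).im) = ∑ i ∈ s, fun f => (ψ i f).im := by
      ext f; simp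
    rw [h]
    exact Submodule.sum_mem _ fun i hi => (hψ i hi).2

theorem HasDegreeLE.normSq {d : ℕ} {ψ : (Fin n → Fin n) → ℂ} (hψ : HasDegreeLE d ψ) :
    (fun f => ‖ψ f‖ ^ 2) ∈ degreeLE (Fin n) (2 * d) := by
  have h : (fun f => ‖ψ f‖ ^ 2) = (fun f => (ψ f).re) * (fun f => (ψ f).re) +
      (fun f => (ψ f).im) * (fun f => (ψ f).im) := by
    ext f
    rw [← Complex.normSq_eq_norm_sq, Complex.normSq_apply]
    rfl
  rw [h, two_mul]
  exact Submodule.add_mem _ (mul_mem_degreeLE hψ.1 hψ.1) (mul_mem_degreeLE hψ.2 hψ.2)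

theorem HasDegreeLE.mulVec {ι : Type*} [Fintype ι] {d : ℕ} {v : (Fin n → Fin n) → ι → ℂ}
    (hv : ∀ i, HasDegreeLE d fun f => v f i) (U : Matrix ι ι ℂ) (i : ι) :
    HasDegreeLE d fun f => U.mulVec (v f) i := by
  refine HasDegreeLE.sum fun j _ => ?_
  simpa using (HasDegreeLE.const 0 (U i j)).mul (hv j)

/-- At a code of `i`, the new amplitude is a sum over the possible answers z of an old amplitude
times the indicator of f i = z, which costs one degree. At other strings the oracle does nothing. -/
theorem HasDegreeLE.oracle_mulVec {d : ℕ} {v : (Fin n → Fin n) → RegBasis q a → ℂ}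
    (hv : ∀ b, HasDegreeLE d fun f => v f b) (b : RegBasis q a) :
    HasDegreeLE (d + 1) fun f => (oracle eIn eOut f a).mulVec (v f) b := by
  simp only [oracle_mulVec_apply]
  obtain ⟨x, y, w⟩ := b
  by_cases hx : ∃ i, eIn i = x
  · obtain ⟨i, rfl⟩ := hx
    have h : (fun f => v f (oracleMap eIn eOut f (eIn i, y, w))) = fun f =>
        ∑ z, v f (eIn i, bxor y (eOut z), w) * (agreeIndicator {i} (fun _ => z) f : ℂ) := by
      ext f
      have : oracleMap eIn eOut f (eIn i, y, w) = (eIn i, bxor y (eOut (f i)), w) := by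
        simp [oracleMap, encodedFun, eIn.injective.extend_apply]
      rw [this, Finset.sum_eq_single_of_mem (f i) (Finset.mem_univ _)]
      · simp [agreeIndicator]
      · intro z _ hz
        simp [agreeIndicator, hz.symm]
    rw [h]
    refine HasDegreeLE.sum fun z _ => (hv _).mul ⟨?_, ?_⟩
    · exact agreeIndicator_mem_degreeLE (by simp) _
    · exact const_mem_degreeLE 1 0
  · have h : ∀ f, oracleMap eIn eOut f (x, y, w) = (x, y, w) := by
      intro f
      have : encodedFun eIn eOut f x = fun _ => false :=
        Function.extend_apply' _ _ _ hx
      simp only [oracleMap, this]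
      congr
      ext k
      simp [bxor]
    simp only [h]
    exact (hv _).mono (Nat.le_succ d)

end Amplitudes

section SquaredNorm

variable {ι : Type*} [Fintype ι]

theorem sum_norm_sq_eq (v : ι → ℂ) : ((∑ b, ‖v b‖ ^ 2 : ℝ) : ℂ) = star v ⬝ᵥ v := by
  simp only [dotProduct, Pi.star_apply, RCLike.star_def, Complex.conj_mul']
  push_cast
  rfl

theorem star_mulVec_dotProduct_mulVec (M : Matrix ι ι ℂ) (v : ι → ℂ) :
    star (M.mulVec v) ⬝ᵥ M.mulVec v = star v ⬝ᵥ (star M * M).mulVec v := by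
  rw [Matrix.star_mulVec, ← Matrix.dotProduct_mulVec, Matrix.mulVec_mulVec, Matrix.star_eq_conjTranspose]

variable [DecidableEq ι]

theorem sum_norm_sq_unitary_mulVec (U : Matrix.unitaryGroup ι ℂ) (v : ι → ℂ) :
    ∑ b, ‖(U : Matrix ι ι ℂ).mulVec v b‖ ^ 2 = ∑ b, ‖v b‖ ^ 2 := by
  apply Complex.ofReal_injective
  rw [sum_norm_sq_eq, sum_norm_sq_eq, star_mulVec_dotProduct_mulVec,
    Matrix.mem_unitaryGroup_iff'.mp U.2, Matrix.one_mulVec]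

/-- Pythagoras for the complementary projections `M` and `1 - M`. -/
theorem sum_norm_sq_proj_mulVec_le {M : Matrix ι ι ℂ} (hM : IsStarProjection M) (v : ι → ℂ) :
    ∑ b, ‖M.mulVec v b‖ ^ 2 ≤ ∑ b, ‖v b‖ ^ 2 := by
  have key : ∀ {P : Matrix ι ι ℂ}, IsStarProjection P → star P * P = P := fun hP => by
    rw [hP.isSelfAdjoint.star_eq, hP.isIdempotentElem.eq]
  have h : ∑ b, ‖M.mulVec v b‖ ^ 2 + ∑ b, ‖(1 - M).mulVec v b‖ ^ 2 = ∑ b, ‖v b‖ ^ 2 := by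
    apply Complex.ofReal_injective
    rw [Complex.ofReal_add, sum_norm_sq_eq, sum_norm_sq_eq, sum_norm_sq_eq,
      star_mulVec_dotProduct_mulVec, star_mulVec_dotProduct_mulVec, key hM, key hM.one_sub,
      ← dotProduct_add, ← Matrix.add_mulVec, add_sub_cancel, Matrix.one_mulVec]
  have h0 : 0 ≤ ∑ b, ‖(1 - M).mulVec v b‖ ^ 2 := by positivity
  linarith

end SquaredNorm

namespace QueryAlgorithm

variable {n q : ℕ} (A : QueryAlgorithm q) (eIn eOut : Fin n ↪ Bits q)

theorem hasDegreeLE_state (t : ℕ) (b : RegBasis q A.work) :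
    HasDegreeLE t fun f => A.state (oracle eIn eOut f A.work) t b := by
  induction t generalizing b with
  | zero => exact HasDegreeLE.const 0 _
  | succ t ih => exact HasDegreeLE.mulVec (fun b => HasDegreeLE.oracle_mulVec ih b) _ b

theorem probRToOne_mem_degreeLE :
    (fun f => A.probRToOne eIn eOut f) ∈ degreeLE (Fin n) (2 * A.queries) := by
  have h : (fun f => A.probRToOne eIn eOut f) = ∑ b, fun f =>
      ‖A.proj.mulVec (A.state (oracle eIn eOut f A.work) A.queries) b‖ ^ 2 := by
    ext f
    simp [probRToOne, acceptProb]
  rw [h]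
  exact Submodule.sum_mem _ fun b _ =>
    (HasDegreeLE.mulVec (A.hasDegreeLE_state eIn eOut A.queries) A.proj b).normSq

theorem sum_norm_sq_state (f : Fin n → Fin n) (t : ℕ) :
    ∑ b, ‖A.state (oracle eIn eOut f A.work) t b‖ ^ 2 = 1 := by
  induction t with
  | zero =>
    simp only [state]
    rw [sum_norm_sq_unitary_mulVec, initState, Finset.sum_eq_single_of_mem _ (Finset.mem_univ
      ((fun _ => false, fun _ => false, fun _ => false) : RegBasis q A.work))]
    · simp
    · intro b _ hb
      simp [Pi.single_eq_of_ne hb]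
  | succ t ih =>
    simp only [state]
    rw [sum_norm_sq_unitary_mulVec, ← ih]
    simp only [oracle_mulVec_apply]
    exact Equiv.sum_comp (Function.Involutive.toPerm (oracleMap eIn eOut f)
      (oracleMap_oracleMap f)) fun b => ‖A.state (oracle eIn eOut f A.work) t b‖ ^ 2

theorem probRToOne_nonneg (f : Fin n → Fin n) : 0 ≤ A.probRToOne eIn eOut f :=
  Finset.sum_nonneg fun _ _ => by positivity

theorem probRToOne_le_one (f : Fin n → Fin n) : A.probRToOne eIn eOut f ≤ 1 :=
  (sum_norm_sq_proj_mulVec_le A.proj_isStarProjection _).trans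
    (A.sum_norm_sq_state eIn eOut f A.queries).le

end QueryAlgorithm

end XorCollision

/-! ### Lower bounds on the degree of Q. -/

namespace XorCollision

open Polynomial

theorem exists_restriction_to_line {Q : MvPolynomial (Fin 3) ℝ} {d : ℕ} (hQ : Q.totalDegree ≤ d)
    (c e : Fin 3 → ℝ) :
    ∃ p : ℝ[X], p.natDegree ≤ d ∧
      ∀ x, p.eval x = MvPolynomial.eval (fun i => c i + e i * x) Q := by
  set l : Fin 3 → ℝ[X] := fun i => Polynomial.C (c i) + Polynomial.C (e i) * X with hl
  refine ⟨MvPolynomial.aeval l Q, ?_, fun x => ?_⟩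
  · have := MvPolynomial.aeval_natDegree_le Q hQ l (n := 1) fun i => by
      exact (congrArg natDegree (add_comm _ _)).trans_le natDegree_linear_le
    rwa [mul_one] at this
  · have h : ((Polynomial.aeval x).comp (MvPolynomial.aeval l) : MvPolynomial (Fin 3) ℝ →ₐ[ℝ] ℝ) =
        MvPolynomial.aeval fun i => c i + e i * x := by
      refine MvPolynomial.algHom_ext fun i => ?_
      simp [hl]
    have h' := DFunLike.congr_fun h Q
    rw [AlgHom.comp_apply, Polynomial.coe_aeval_eq_eval] at h'
    exact h'.trans (by rw [← MvPolynomial.coe_aeval_eq_eval]; rfl)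

/-- Provides the net for `sub_le_of_variation`. Only positive integers serve as fibre sizes, so
points below 1 are rounded up. -/
theorem exists_nat_near {α : ℝ} {K : ℕ} (hα0 : 0 ≤ α) (hα1 : α ≤ 1) (hK : 1 ≤ K) {x : ℝ}
    (hx : x ∈ Set.Icc α K) :
    ∃ k : ℕ, 1 ≤ k ∧ k ≤ K ∧ (k : ℝ) ∈ Set.Icc α (K : ℝ) ∧ |x - k| ≤ 1 := by
  have hK' : (1 : ℝ) ≤ K := by exact_mod_cast hK
  rcases le_or_gt x 1 with h | h
  · refine ⟨1, le_rfl, hK, ⟨by simpa using hα1, by simpa using hK'⟩, ?_⟩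
    rw [Nat.cast_one, abs_le]
    constructor <;> linarith [hx.1]
  · have h1 := Nat.floor_le (zero_le_one.trans h.le)
    have h2 := Nat.lt_floor_add_one x
    have h3 : 1 ≤ ⌊x⌋₊ := Nat.le_floor (by simpa using h.le)
    have h3' : (1 : ℝ) ≤ ⌊x⌋₊ := by exact_mod_cast h3
    refine ⟨⌊x⌋₊, h3, ?_, ⟨by linarith, h1.trans hx.2⟩, ?_⟩
    · have := h1.trans hx.2
      exact_mod_cast this
    · rw [abs_le]; constructor <;> linarith

theorem le_mul_of_sq_le {t d : ℕ} (h : (t : ℝ) ^ 2 ≤ (20000 * d) ^ 2) : t ≤ 20000 * d := by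
  have := (sq_le_sq₀ (by positivity) (by positivity)).mp h
  exact_mod_cast this

section DegreeBound

variable {n r N t d : ℕ} {Q : MvPolynomial (Fin 3) ℝ}

/-- The case in which functions that are half one-to-one and half `r`-to-one are told apart from
one-to-one functions. -/
theorem degree_bound_of_ge (hr : 2 ≤ r) (hn : n = r * N) (ht : 10 ≤ t) (htN : t ^ 3 ≤ N)
    (hQ : Q.totalDegree ≤ d)
    (hval : ∀ m a b : ℕ, 0 < a → 0 < b → m ≤ n → a ∣ m → b ∣ n - m →
      MvPolynomial.eval ![(m : ℝ), a, b] Q ∈ Set.Icc (0 : ℝ) 1)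
    (h1 : MvPolynomial.eval ![((r * (N / 2) : ℕ) : ℝ), 1, 1] Q ≤ 34 / 100)
    (hmid : 1 / 2 ≤ MvPolynomial.eval ![((r * (N / 2) : ℕ) : ℝ), 1, r] Q) : t ≤ 20000 * d := by
  set M := r * (N / 2) with hM
  obtain ⟨g, hgd, hg⟩ := exists_restriction_to_line hQ ![(M : ℝ), 1, 0] ![0, 0, 1]
  have hg' : ∀ x, g.eval x = MvPolynomial.eval ![(M : ℝ), 1, x] Q := by
    intro x
    rw [hg]
    congr 2
    ext i; fin_cases i <;> simp
  have ht' : (10 : ℝ) ≤ t := by exact_mod_cast ht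
  have hr' : (2 : ℝ) ≤ r := by exact_mod_cast hr
  have hN1000 : 1000 ≤ N := le_trans (by nlinarith [Nat.pow_le_pow_left ht 3]) htN
  have h2M : 2 * M ≤ n := by
    rw [hn, hM]
    nlinarith [Nat.mul_div_le N 2]
  have h2M' : n ≤ 2 * M + r := by
    rw [hn, hM]
    have : N ≤ 2 * (N / 2) + 1 := by omega
    nlinarith
  by_contra! hcon
  have hbd : ∀ k : ℕ, 1 ≤ k → k ≤ r * t ^ 2 → |g.eval (k : ℝ)| ≤ 2 := by
    intro k hk1 hk
    by_contra! hlarge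
    -- On this line `b = k` is fixed and the `k`-to-one part has k x points, so every integer x up
    -- to n / k gives a realisable profile. The value g(k) occurs at (n - M) / k, which need not be
    -- an integer.
    obtain ⟨h, hhd, hh⟩ := exists_restriction_to_line hQ ![(n : ℝ), 1, k] ![-k, 0, 0]
    have hh' : ∀ x, h.eval x = MvPolynomial.eval ![(n : ℝ) - k * x, 1, k] Q := by
      intro x
      rw [hh]
      congr 2
      ext i; fin_cases i <;> simp [sub_eq_add_neg]
    have hk0 : (0 : ℝ) < k := by exact_mod_cast hk1
    have htL : t ≤ n / k := by
      rw [Nat.le_div_iff_mul_le hk1, hn]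
      calc t * k ≤ t * (r * t ^ 2) := Nat.mul_le_mul_left t hk
        _ = r * t ^ 3 := by ring
        _ ≤ r * N := Nat.mul_le_mul_left r htN
    have hint : ∀ i : ℕ, i ≤ n / k → |h.eval (i : ℝ)| ≤ 1 := by
      intro i hi
      have hki : k * i ≤ n := by
        rw [mul_comm]; exact (Nat.le_div_iff_mul_le hk1).mp hi
      have := hval (n - k * i) 1 k one_pos hk1 (Nat.sub_le _ _) (one_dvd _)
        (by rw [Nat.sub_sub_self hki]; exact dvd_mul_right k i)
      rw [Nat.cast_sub hki] at this
      push_cast at this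
      rw [hh', abs_of_nonneg this.1]
      exact this.2
    have hLr : (10 : ℝ) ≤ (n / k : ℕ) := ht'.trans (by exact_mod_cast htL)
    have hL1 : ((n / k : ℕ) : ℝ) * k ≤ n := by exact_mod_cast Nat.div_mul_le_self n k
    have hL2 : (n : ℝ) ≤ ((n / k : ℕ) + 1) * k := by
      have := Nat.lt_mul_div_succ n hk1
      have : n ≤ (n / k + 1) * k := by rw [mul_comm]; exact this.le
      exact_mod_cast this
    have h2Mr : 2 * (M : ℝ) ≤ n := by exact_mod_cast h2M
    have h2Mr' : (n : ℝ) ≤ 2 * M + r := by exact_mod_cast h2M'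
    have hrn : (10 : ℝ) * r ≤ n := by
      have : 10 * r ≤ n := by rw [hn]; nlinarith
      exact_mod_cast this
    have := le_of_large_in_middle hhd hint (ξ := (n - M) / k)
      (by rw [le_div_iff₀ hk0]; nlinarith)
      (by rw [div_le_iff₀ hk0]; nlinarith)
      (by
        rw [hh', mul_div_cancel₀ _ hk0.ne', sub_sub_cancel, ← hg']
        exact hlarge.le)
    omega
  have hK1 : 1 ≤ r * t ^ 2 := by nlinarith [Nat.pow_le_pow_left ht 2]
  have hrK : (r : ℝ) * 100 ≤ (r * t ^ 2 : ℕ) := by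
    push_cast
    have : (100 : ℝ) ≤ t ^ 2 := by nlinarith
    nlinarith
  -- The length r t² is as large as k t ≤ n allows for all `k` in the range, given t³ ≤ N; the
  -- variation happens at scale `r`.
  have hvar := sub_le_of_variation hgd (α := 1) (β := (r * t ^ 2 : ℕ)) (by linarith)
    (fun x hx => by
      obtain ⟨k, hk1, hkK, hkI, hxk⟩ := exists_nat_near zero_le_one le_rfl hK1 hx
      exact ⟨k, hkI, hxk, hbd k hk1 hkK⟩)
    (u := r) (v := r) ⟨by linarith, by linarith⟩ (by linarith) (by linarith)
    (by
      rw [hg', hg']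
      exact le_trans (by linarith) (le_abs_self _))
  refine absurd (le_mul_of_sq_le ?_) (not_le.mpr hcon)
  push_cast at hvar
  have h3 : (r : ℝ) * t ^ 2 ≤ r * (2 * (400 * d) ^ 2) := by nlinarith
  have h4 := le_of_mul_le_mul_left h3 (by linarith)
  nlinarith [sq_nonneg (d : ℝ)]

/-- The case in which functions that are half one-to-one and half `r`-to-one are told apart from
`r`-to-one functions. -/
theorem degree_bound_of_le (hr : 2 ≤ r) (hn : n = r * N) (ht : 10 ≤ t) (htN : t ^ 3 ≤ N)
    (hQ : Q.totalDegree ≤ d)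
    (hval : ∀ m a b : ℕ, 0 < a → 0 < b → m ≤ n → a ∣ m → b ∣ n - m →
      MvPolynomial.eval ![(m : ℝ), a, b] Q ∈ Set.Icc (0 : ℝ) 1)
    (h2 : 66 / 100 ≤ MvPolynomial.eval ![((r * (N / 2) : ℕ) : ℝ), r, r] Q)
    (hmid : MvPolynomial.eval ![((r * (N / 2) : ℕ) : ℝ), 1, r] Q ≤ 1 / 2) : t ≤ 20000 * d := by
  -- Here a = r x varies: x = 1 / r is the mixed function and x = 1 the `r`-to-one function, so the
  -- variation happens at scale 1.
  obtain ⟨g, hgd, hg⟩ := exists_restriction_to_line hQ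
    ![((r * (N / 2) : ℕ) : ℝ), 0, r] ![0, r, 0]
  have hg' : ∀ x, g.eval x = MvPolynomial.eval ![((r * (N / 2) : ℕ) : ℝ), r * x, r] Q := by
    intro x
    rw [hg]
    congr 2
    ext i; fin_cases i <;> simp
  have ht' : (10 : ℝ) ≤ t := by exact_mod_cast ht
  have hr' : (2 : ℝ) ≤ r := by exact_mod_cast hr
  have hr0 : (0 : ℝ) < r := by linarith
  by_contra! hcon
  have hbd : ∀ k : ℕ, 1 ≤ k → k ≤ t ^ 2 → |g.eval (k : ℝ)| ≤ 2 := by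
    intro k hk1 hk
    by_contra! hlarge
    -- Now a = r k is fixed and m = r k x. Both `m` and `n` are multiples of `r`, so the remaining
    -- points always split into fibres of size `r`.
    obtain ⟨h, hhd, hh⟩ := exists_restriction_to_line hQ ![0, r * k, r] ![r * k, 0, 0]
    have hh' : ∀ x, h.eval x = MvPolynomial.eval ![(r : ℝ) * k * x, r * k, r] Q := by
      intro x
      rw [hh]
      congr 2
      ext i; fin_cases i <;> simp
    have hk0 : (0 : ℝ) < k := by exact_mod_cast hk1
    have htL : t ≤ N / k := by
      rw [Nat.le_div_iff_mul_le hk1]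
      calc t * k ≤ t * t ^ 2 := Nat.mul_le_mul_left t hk
        _ = t ^ 3 := by ring
        _ ≤ N := htN
    have hint : ∀ i : ℕ, i ≤ N / k → |h.eval (i : ℝ)| ≤ 1 := by
      intro i hi
      have hki : k * i ≤ N := by
        rw [mul_comm]; exact (Nat.le_div_iff_mul_le hk1).mp hi
      have := hval (r * k * i) (r * k) r (by positivity) (by omega)
        (by rw [hn, mul_assoc]; exact Nat.mul_le_mul_left r hki) (dvd_mul_right _ _)
        (by
          rw [hn, mul_assoc]
          exact Nat.dvd_sub (dvd_mul_right _ _) (dvd_mul_right _ _))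
      push_cast at this
      rw [hh', abs_of_nonneg this.1]
      exact this.2
    have hLr : (10 : ℝ) ≤ (N / k : ℕ) := ht'.trans (by exact_mod_cast htL)
    have hL1 : ((N / k : ℕ) : ℝ) * k ≤ N := by exact_mod_cast Nat.div_mul_le_self N k
    have hL2 : (N : ℝ) ≤ ((N / k : ℕ) + 1) * k := by
      have := Nat.lt_mul_div_succ N hk1
      have : N ≤ (N / k + 1) * k := by rw [mul_comm]; exact this.le
      exact_mod_cast this
    have hN1 : 2 * ((N / 2 : ℕ) : ℝ) ≤ N := by exact_mod_cast Nat.mul_div_le N 2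
    have hN2 : (N : ℝ) ≤ 2 * ((N / 2 : ℕ) : ℝ) + 1 := by
      exact_mod_cast (by omega : N ≤ 2 * (N / 2) + 1)
    have hk1' : (1 : ℝ) ≤ k := by exact_mod_cast hk1
    have := le_of_large_in_middle hhd hint (ξ := ((N / 2 : ℕ) : ℝ) / k)
      (by rw [le_div_iff₀ hk0]; nlinarith)
      (by rw [div_le_iff₀ hk0]; nlinarith)
      (by
        rw [hh', mul_assoc (r : ℝ) k, mul_div_cancel₀ _ hk0.ne', ← Nat.cast_mul, ← hg']
        exact hlarge.le)
    omega
  have hK1 : 1 ≤ t ^ 2 := by nlinarith [Nat.pow_le_pow_left ht 2]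
  have hK : (100 : ℝ) ≤ (t ^ 2 : ℕ) := by
    push_cast
    nlinarith
  have hα : (1 : ℝ) / r ≤ 1 := by rw [div_le_one hr0]; linarith
  have hα0 : (0 : ℝ) ≤ 1 / r := by positivity
  have hvar := sub_le_of_variation hgd (α := 1 / r) (β := (t ^ 2 : ℕ)) (by linarith)
    (fun x hx => by
      obtain ⟨k, hk1, hkK, hkI, hxk⟩ := exists_nat_near hα0 hα hK1 hx
      exact ⟨k, hkI, hxk, hbd k hk1 hkK⟩)
    (u := 1) (v := 1) ⟨by linarith, by linarith⟩ (by linarith) le_rfl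
    (by
      rw [hg', hg', mul_one, mul_one_div_cancel hr0.ne']
      exact le_trans (by linarith) (le_abs_self _))
  refine absurd (le_mul_of_sq_le ?_) (not_le.mpr hcon)
  push_cast at hvar hK
  nlinarith [sq_nonneg (d : ℝ)]

end DegreeBound

/-! ### From the success probabilities to values of Q. -/

section Average

variable {q n r : ℕ} {A : QueryAlgorithm q} {eIn eOut : Fin n ↪ Bits q}

open scoped Classical in
-- The good 99% accept with probability at most 1/3 and the rest at most 1; the constant is 1 - 0.99
-- * 2/3.
theorem sum_oneToOne_le (hA : Distinguishes A eIn eOut r) :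
    ∑ f : Fin n → Fin n with Function.Injective f, A.probRToOne eIn eOut f ≤
      34 / 100 * (Finset.univ.filter fun f : Fin n → Fin n => Function.Injective f).card := by
  set S := Finset.univ.filter fun f : Fin n → Fin n => Function.Injective f with hS
  set G := S.filter fun f => 2 / 3 ≤ A.probOneToOne eIn eOut f with hG
  have h := hA.1
  have hS' : oneToOneFuns n = (S : Set (Fin n → Fin n)) := by ext f; simp [oneToOneFuns, hS]
  have hG' : {f ∈ oneToOneFuns n | 2 / 3 ≤ A.probOneToOne eIn eOut f} =
      (G : Set (Fin n → Fin n)) := by ext f; simp [oneToOneFuns, hS, hG]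
  rw [hG', hS', Set.ncard_coe_finset, Set.ncard_coe_finset] at h
  have hle : ∀ f ∈ S, A.probRToOne eIn eOut f ≤
      1 - if 2 / 3 ≤ A.probOneToOne eIn eOut f then 2 / 3 else 0 := by
    intro f _
    split_ifs with hf
    · rw [QueryAlgorithm.probOneToOne] at hf; linarith
    · linarith [A.probRToOne_le_one eIn eOut f]
  refine (Finset.sum_le_sum hle).trans ?_
  rw [Finset.sum_sub_distrib, ← Finset.sum_filter, Finset.sum_const, Finset.sum_const, ← hG,
    nsmul_eq_mul, nsmul_eq_mul]
  linarith

open scoped Classical in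
theorem le_sum_rToOne (hA : Distinguishes A eIn eOut r) :
    66 / 100 * (Finset.univ.filter fun f : Fin n → Fin n => IsRToOne r f).card ≤
      ∑ f : Fin n → Fin n with IsRToOne r f, A.probRToOne eIn eOut f := by
  set S := Finset.univ.filter fun f : Fin n → Fin n => IsRToOne r f with hS
  set G := S.filter fun f => 2 / 3 ≤ A.probRToOne eIn eOut f with hG
  have h := hA.2
  have hS' : rToOneFuns n r = (S : Set (Fin n → Fin n)) := by ext f; simp [rToOneFuns, hS]
  have hG' : {f ∈ rToOneFuns n r | 2 / 3 ≤ A.probRToOne eIn eOut f} =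
      (G : Set (Fin n → Fin n)) := by ext f; simp [rToOneFuns, hS, hG]
  rw [hG', hS', Set.ncard_coe_finset, Set.ncard_coe_finset] at h
  have hle : ∀ f ∈ S, (if 2 / 3 ≤ A.probRToOne eIn eOut f then (2 / 3 : ℝ) else 0) ≤
      A.probRToOne eIn eOut f := by
    intro f _
    split_ifs with hf
    · exact hf
    · exact A.probRToOne_nonneg eIn eOut f
  refine le_trans ?_ (Finset.sum_le_sum hle)
  rw [← Finset.sum_filter, Finset.sum_const, ← hG, nsmul_eq_mul]
  linarith

theorem IsRToOne.relabel {f : Fin n → Fin n} (hf : IsRToOne r f) (σ τ : Equiv.Perm (Fin n)) :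
    IsRToOne r fun x => τ (f (σ x)) := by
  rintro _ ⟨x, rfl⟩
  have h : (fun x => τ (f (σ x))) ⁻¹' {τ (f (σ x))} = σ ⁻¹' (f ⁻¹' {f (σ x)}) := by
    ext z; simp
  show ((fun x => τ (f (σ x))) ⁻¹' {τ (f (σ x))}).ncard = r
  rw [h, Set.ncard_preimage_of_injective_subset_range σ.injective (by simp)]
  exact hf _ ⟨_, rfl⟩

theorem exists_isRToOne (hr : 0 < r) (hrn : r ∣ n) : ∃ f : Fin n → Fin n, IsRToOne r f := by
  obtain ⟨f, A, hA, hA', -⟩ := exists_hasProfile hr hr le_rfl hrn (by simp)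
  refine ⟨f, ?_⟩
  rintro _ ⟨x, rfl⟩
  have h : (Finset.univ.filter fun z => f z = f x).card = r := by
    by_cases hx : f x ∈ A
    · exact hA x hx
    · exact hA' x hx
  rw [← h, ← Set.ncard_coe_finset]
  congr 1
  ext z
  simp

/-- The polynomial obtained from a query algorithm by averaging its acceptance probability. -/
theorem exists_poly_of_distinguishes {N : ℕ} (hr : 0 < r) (hn : n = r * N)
    (hA : Distinguishes A eIn eOut r) :
    ∃ Q : MvPolynomial (Fin 3) ℝ, Q.totalDegree ≤ 2 * A.queries ∧
      (∀ m a b : ℕ, 0 < a → 0 < b → m ≤ n → a ∣ m → b ∣ n - m →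
        MvPolynomial.eval ![(m : ℝ), a, b] Q ∈ Set.Icc (0 : ℝ) 1) ∧
      MvPolynomial.eval ![((r * (N / 2) : ℕ) : ℝ), 1, 1] Q ≤ 34 / 100 ∧
      66 / 100 ≤ MvPolynomial.eval ![((r * (N / 2) : ℕ) : ℝ), r, r] Q := by
  classical
  obtain ⟨Q, hQ, hval, hav⟩ := exists_poly_average (A.probRToOne_mem_degreeLE eIn eOut)
    (A.probRToOne_nonneg eIn eOut) (A.probRToOne_le_one eIn eOut)
  have hM : r * (N / 2) ≤ n := by
    rw [hn]; exact Nat.mul_le_mul_left r (Nat.div_le_self N 2)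
  refine ⟨Q, hQ, ?_, ?_, ?_⟩
  · intro m a b ha hb hm ham hbm
    obtain ⟨f, B, hf⟩ := exists_hasProfile ha hb hm ham hbm
    exact hval f B m a b hf
  · have h := hav (Finset.univ.filter fun f => Function.Injective f)
      (by
        intro f hf σ τ
        rw [Finset.mem_filter] at hf ⊢
        exact ⟨Finset.mem_univ _, τ.injective.comp (hf.2.comp σ.injective)⟩)
      (r * (N / 2)) 1 1
      (by
        intro f hf
        rw [Finset.mem_filter, ← isRToOne_one_iff] at hf
        exact exists_hasProfile_of_isRToOne hf.2 one_pos (one_dvd _) hM)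
    have h2 := sum_oneToOne_le hA
    have hpos : (0 : ℝ) < (Finset.univ.filter fun f : Fin n → Fin n =>
        Function.Injective f).card := by
      rw [Nat.cast_pos, Finset.card_pos]
      exact ⟨id, by simp [Function.injective_id]⟩
    rw [h, mul_comm] at h2
    simpa using le_of_mul_le_mul_right h2 hpos
  · have h := hav (Finset.univ.filter fun f => IsRToOne r f)
      (by
        intro f hf σ τ
        rw [Finset.mem_filter] at hf ⊢
        exact ⟨Finset.mem_univ _, hf.2.relabel σ τ⟩)
      (r * (N / 2)) r r
      (by
        intro f hf
        rw [Finset.mem_filter] at hf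
        exact exists_hasProfile_of_isRToOne hf.2 hr (dvd_mul_right _ _) hM)
    have h2 := le_sum_rToOne hA
    have hpos : (0 : ℝ) < (Finset.univ.filter fun f : Fin n → Fin n => IsRToOne r f).card := by
      obtain ⟨f, hf⟩ := exists_isRToOne hr (n := n) (hn ▸ dvd_mul_right r N)
      rw [Nat.cast_pos, Finset.card_pos]
      exact ⟨f, by simpa using hf⟩
    rw [h, mul_comm] at h2
    exact le_of_mul_le_mul_left h2 hpos

end Average

end XorCollision

theorem mainTheorem7 :
    ∃ c : ℝ, 0 < c ∧
      ∀ n r : ℕ, 0 < n → 2 ≤ r → r ∣ n →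
      ∀ eIn eOut : Fin n ↪ XorCollision.Bits (Nat.clog 2 n),
      ∀ A : XorCollision.QueryAlgorithm (Nat.clog 2 n),
        XorCollision.Distinguishes A eIn eOut r →
          c * ((n : ℝ) / (r : ℝ)) ^ (1 / 3 : ℝ) ≤ (A.queries : ℝ) := by
  -- The degree bound is t ≤ 40000 T, and N^(1/3) < t + 1 ≤ 2 t once t ≥ 10.
  refine ⟨1 / 80000, by norm_num, ?_⟩
  intro n r hn hr hrn eIn eOut A hA
  obtain ⟨N, hN⟩ := hrn
  obtain ⟨Q, hQ, hval, h1, h2⟩ := XorCollision.exists_poly_of_distinguishes (by omega) hN hA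
  have hr0 : (r : ℝ) ≠ 0 := by positivity
  have hdiv : (n : ℝ) / r = N := by rw [hN, Nat.cast_mul, mul_div_cancel_left₀ _ hr0]
  rw [hdiv]
  have hroot : 0 ≤ (N : ℝ) ^ (1 / 3 : ℝ) := by positivity
  set t := ⌊(N : ℝ) ^ (1 / 3 : ℝ)⌋₊ with ht
  have hfl := Nat.floor_le hroot
  have hlt := Nat.lt_floor_add_one ((N : ℝ) ^ (1 / 3 : ℝ))
  rw [← ht] at hfl hlt
  rcases lt_or_ge t 10 with ht10 | ht10
  -- For small `t` a single query suffices: without queries Q is constant and cannot be both at most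
  -- 0.34 and at least 0.66.
  · have hT : 1 ≤ A.queries := by
      by_contra! h0
      have hdeg : Q.totalDegree = 0 := by omega
      rw [MvPolynomial.totalDegree_eq_zero_iff_eq_C.mp hdeg] at h1 h2
      simp only [MvPolynomial.eval_C] at h1 h2
      linarith
    have hT' : (1 : ℝ) ≤ A.queries := by exact_mod_cast hT
    have : (t : ℝ) ≤ 9 := by exact_mod_cast Nat.lt_succ_iff.mp ht10
    linarith
  · have htN : t ^ 3 ≤ N := by
      have h3 : (t : ℝ) ^ 3 ≤ ((N : ℝ) ^ (1 / 3 : ℝ)) ^ 3 :=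
        pow_le_pow_left₀ (by positivity) hfl 3
      rw [← Real.rpow_natCast ((N : ℝ) ^ (1 / 3 : ℝ)), ← Real.rpow_mul (by positivity)] at h3
      norm_num at h3
      exact_mod_cast h3
    have hbound : t ≤ 20000 * (2 * A.queries) := by
      rcases le_total (1 / 2) (MvPolynomial.eval ![((r * (N / 2) : ℕ) : ℝ), 1, r] Q) with h | h
      · exact XorCollision.degree_bound_of_ge hr hN ht10 htN hQ hval h1 h
      · exact XorCollision.degree_bound_of_le hr hN ht10 htN hQ hval h2 h
    have hb' : (t : ℝ) ≤ 20000 * (2 * A.queries) := by exact_mod_cast hbound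
    have ht1 : (10 : ℝ) ≤ t := by exact_mod_cast ht10
    linarith
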